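/- Consider finitely many DAG tasks $\tau_i$ and finitely many shared resources $\ell_q$. Task $\tau_i$ has a finite DAG with a unique head vertex and a unique tail vertex, worst-case execution times $c(v)\ge 0$ of its vertices, total worst-case execution time $C_i=\sum_v c(v)$, longest length $\mathcal L_i$ (sum of $c(v)$) of a path from head to tail, period $T_i$ (consecutive jobs of $\tau_i$ are released at least $T_i$ apart) and relative deadline $D_i$, $0<D_i\le T_i$. Each job of $\tau_i$ accesses $\ell_q$ at most $N_{i,q}$ times, each access lasting at most $L_{i,q}$ (access times are part of the execution times, spinning times are not). The task is scheduled by a work-conserving scheduler exclusively on $m_i\ge 1$ processors. Resources are protected by non-nested spin locks (spinning and lock holding are non-preemptive, a vertex spins only while the requested lock is held by another vertex), and requests for the same resource are served in FIFO order. Let $R_i$ be the worst-case response time of $\tau_i$, i.e. the supremum of (finish time $-$ release time) over its jobs, all jobs being assumed to finish eventually. Put \[ \eta_{i,j}^q=\begin{cases}\left\lceil (D_i+D_j)/T_j\right\rceil & \text{if } N_{i,q}>0 \text{ and } N_{j,q}>0,\\ 0&\text{otherwise,}\end{cases} \qquad \Delta_{i,q}=\min\{N_{i,q},m_i\}\Bigl(m_i-\tfrac{\min\{N_{i,q},m_i\}+1}{2}\Bigr),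 \] \[ F^I_{i,q}(x)=\bigl((N_{i,q}-x)(m_i-1)-\max\{1-x,0\}\,\Delta_{i,q}\bigr)L_{i,q}, \] \[ F^O_{i,q}(x)=\sum_{j\ne i}\min\bigl\{m_i\,\eta_{i,j}^q N_{j,q},\ (N_{i,q}+(m_i-1)x)\,m_j\bigr\}L_{j,q}, \] \[ \mathcal B_i=\frac{1}{m_i}\Bigl(C_i+(m_i-1)\mathcal L_i+\sum_{q:\,N_{i,q}>0}\ \max_{x\in\{0,1,\dots,N_{i,q}\}}\bigl(F^I_{i,q}(x)+F^O_{i,q}(x)\bigr)\Bigr). \] Suppose that either all tasks meet their deadlines ($R_j\le D_j$ for all $j$), or the bounds do ($\mathcal B_j\le D_j$ for all $j$). Then $R_i\le \mathcal B_i$ for every $i$. -/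

import Mathlib

open MeasureTheory

/-- A system of DAG tasks (indexed by `ι`) sharing resources (indexed by `ρ`) under federated
scheduling. -/
structure TaskSystem.{u, v, w} (ι : Type u) (ρ : Type v) where
  /-- vertices of the DAG of each task -/
  V : ι → Type w
  fintypeV : ∀ i, Fintype (V i)
  /-- `E i u v`: there is an edge from `u` to `v`, i.e. `u` is a predecessor of `v` -/
  E : ∀ i, V i → V i → Prop
  acyclic : ∀ i v, ¬ Relation.TransGen (E i) v v
  head : ∀ i, V i
  tail : ∀ i, V i
  /-- the head is the unique vertex without predecessors -/
  head_iff : ∀ i v, (∀ u, ¬ E i u v) ↔ v = head i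
  /-- the tail is the unique vertex without successors -/
  tail_iff : ∀ i v, (∀ u, ¬ E i v u) ↔ v = tail i
  /-- worst-case execution time of a vertex (lock holding included, spinning excluded) -/
  c : ∀ i, V i → ℝ
  c_nonneg : ∀ i v, 0 ≤ c i v
  /-- (minimal) inter-release time -/
  period : ι → ℝ
  /-- relative deadline -/
  deadline : ι → ℝ
  deadline_pos : ∀ i, 0 < deadline i
  deadline_le_period : ∀ i, deadline i ≤ period i
  /-- number of processors exclusively assigned to the task -/
  m : ι → ℕ
  m_pos : ∀ i, 0 < m i
  /-- worst-case number of accesses of a job of task `i` to resource `q` -/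
  N : ι → ρ → ℕ
  /-- worst-case duration of a single access of task `i` to resource `q` -/
  L : ι → ρ → ℝ
  L_nonneg : ∀ i q, 0 ≤ L i q

attribute [instance] TaskSystem.fintypeV

namespace TaskSystem

variable {ι : Type*} {ρ : Type*} (S : TaskSystem ι ρ)

/-- Total WCET of a task. -/
noncomputable def totalWCET (i : ι) : ℝ := ∑ v, S.c i v

/-- Complete paths: from the head to the tail along edges. -/
def IsCompletePath (i : ι) (l : List (S.V i)) : Prop :=
  l.IsChain (S.E i) ∧ l.head? = some (S.head i) ∧ l.getLast? = some (S.tail i)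

/-- Longest length of a complete path. The set is finite and non-empty, as the DAG is finite. -/
noncomputable def longestPath (i : ι) : ℝ :=
  sSup {x | ∃ l, S.IsCompletePath i l ∧ x = (l.map (S.c i)).sum}

/-- Upper bound `⌈(D_i + D_j) / T_j⌉` on the number of jobs of `j` contending with a job of `i`
on `q`; zero unless both tasks access `q`. -/
noncomputable def eta (i j : ι) (q : ρ) : ℕ :=
  if 0 < S.N i q ∧ 0 < S.N j q then ⌈(S.deadline i + S.deadline j) / S.period j⌉₊ else 0

/-- `Δ = min{N_{i,q}, m_i} (m_i - (min{N_{i,q}, m_i} + 1) / 2)`. -/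
noncomputable def Delta (i : ι) (q : ρ) : ℝ :=
  min (S.N i q : ℝ) (S.m i) * ((S.m i : ℝ) - (min (S.N i q : ℝ) (S.m i) + 1) / 2)

/-- Intra-task term `F^I(x)`. -/
noncomputable def FI (i : ι) (q : ρ) (x : ℕ) : ℝ :=
  (((S.N i q : ℝ) - x) * ((S.m i : ℝ) - 1) - max (1 - (x : ℝ)) 0 * S.Delta i q) * S.L i q

open Classical in
/-- Inter-task term `F^O(x)`. -/
noncomputable def FO [Fintype ι] (i : ι) (q : ρ) (x : ℕ) : ℝ :=
  ∑ j ∈ Finset.univ.filter (fun j => j ≠ i),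
    min ((S.m i : ℝ) * S.eta i j q * S.N j q)
      (((S.N i q : ℝ) + ((S.m i : ℝ) - 1) * x) * S.m j) * S.L j q

/-- The response time bound; the sum is over the resources accessed by task `i`. -/
noncomputable def fifoBound [Fintype ι] [Fintype ρ] (i : ι) : ℝ :=
  (S.totalWCET i + ((S.m i : ℝ) - 1) * S.longestPath i +
    ∑ q ∈ Finset.univ.filter (fun q => 0 < S.N i q),
      (Finset.range (S.N i q + 1)).sup' Finset.nonempty_range_add_one
        (fun x => S.FI i q x + S.FO i q x)) / S.m i

end TaskSystem

/-- A trace of the system. Jobs of task `i` are numbered by `k : ℕ`. Job `k` of task `i`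
issues `numReq i k` lock requests; a request is a triple `⟨i, k, n⟩`. -/
structure Schedule {ι : Type*} {ρ : Type*} (S : TaskSystem ι ρ) where
  release : ι → ℕ → ℝ
  /-- actual execution time of a vertex of a job -/
  work : ∀ i, ℕ → S.V i → ℝ
  /-- times at which a vertex of a job is executing (holding a lock or not) on a processor -/
  exec : ∀ i, ℕ → S.V i → Set ℝ
  /-- finish time of a vertex of a job -/
  finish : ∀ i, ℕ → S.V i → ℝ
  numReq : ι → ℕ → ℕ
  /-- the vertex that issues the request -/
  vertex : ∀ p : (Σ i, Σ k, Fin (numReq i k)), S.V p.1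
  /-- the requested resource -/
  res : (Σ i, Σ k, Fin (numReq i k)) → ρ
  /-- time at which the request is issued -/
  issue : (Σ i, Σ k, Fin (numReq i k)) → ℝ
  /-- time at which the lock is obtained -/
  acquire : (Σ i, Σ k, Fin (numReq i k)) → ℝ
  /-- time at which the lock is released -/
  done : (Σ i, Σ k, Fin (numReq i k)) → ℝ

namespace Schedule

variable {ι : Type*} {ρ : Type*} {S : TaskSystem ι ρ} (σ : Schedule S)

/-- Lock requests. -/
abbrev Req : Type _ := Σ i, Σ k, Fin (σ.numReq i k)

/-- The times at which a request spins. -/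
def spin (p : σ.Req) : Set ℝ := Set.Ico (σ.issue p) (σ.acquire p)

/-- The times at which a request holds the lock. -/
def hold (p : σ.Req) : Set ℝ := Set.Ico (σ.acquire p) (σ.done p)

/-- Request `p` is issued by vertex `v` of job `k` of task `i`. -/
def IssuedBy (p : σ.Req) (i : ι) (k : ℕ) (v : S.V i) : Prop :=
  ∃ n : Fin (σ.numReq i k), p = ⟨i, k, n⟩ ∧ σ.vertex ⟨i, k, n⟩ = v

/-- Vertex `v` of job `k` of task `i` is spinning at time `t`. -/
def Spinning (i : ι) (k : ℕ) (v : S.V i) (t : ℝ) : Prop :=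
  ∃ p, σ.IssuedBy p i k v ∧ t ∈ σ.spin p

/-- A processor is busy with vertex `v` of job `k` of task `i` at time `t`. -/
def Busy (i : ι) (k : ℕ) (v : S.V i) (t : ℝ) : Prop :=
  t ∈ σ.exec i k v ∨ σ.Spinning i k v t

/-- The vertex is eligible and not yet finished: its job is released and all its predecessors
are finished. -/
def Pending (i : ι) (k : ℕ) (v : S.V i) (t : ℝ) : Prop :=
  σ.release i k ≤ t ∧ (∀ u, S.E i u v → σ.finish i k u ≤ t) ∧ t < σ.finish i k v

/-- The vertices (of all jobs of task `i`) that occupy a processor at time `t`. -/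
def busySet (i : ι) (t : ℝ) : Set (ℕ × S.V i) := {a | σ.Busy i a.1 a.2 t}

/-- Schedules produced by work-conserving federated scheduling with non-nested spin locks
(with no constraint on the order in which requests are served). -/
structure IsLegal : Prop where
  release_sep : ∀ i k, σ.release i k + S.period i ≤ σ.release i (k + 1)
  work_nonneg : ∀ i k v, 0 ≤ σ.work i k v
  work_le : ∀ i k v, σ.work i k v ≤ S.c i v
  exec_measurable : ∀ i k v, MeasurableSet (σ.exec i k v)
  /-- precedence constraints -/
  pending_of_busy : ∀ i k v t, σ.Busy i k v t → σ.Pending i k v t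
  /-- the finish time is the first time at which the job is released, the predecessors are
  finished, the vertex has executed for its execution time, and its requests are completed -/
  finish_isLeast : ∀ i k v, IsLeast
    {t | σ.release i k ≤ t ∧ (∀ u, S.E i u v → σ.finish i k u ≤ t) ∧
      volume (σ.exec i k v ∩ Set.Iio t) = ENNReal.ofReal (σ.work i k v) ∧
      ∀ p, σ.IssuedBy p i k v → σ.done p ≤ t} (σ.finish i k v)
  /-- at most `m i` processors are used by task `i` -/
  capacity : ∀ i t, (σ.busySet i t).encard ≤ S.m i
  /-- no processor of task `i` idles while one of its vertices is waiting for a processor -/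
  work_conserving : ∀ i k v t, σ.Pending i k v t → ¬ σ.Busy i k v t →
    (σ.busySet i t).encard = S.m i
  issue_le_acquire : ∀ p, σ.issue p ≤ σ.acquire p
  acquire_lt_done : ∀ p, σ.acquire p < σ.done p
  /-- lock holders execute non-preemptively -/
  hold_subset_exec : ∀ i k v p, σ.IssuedBy p i k v → σ.hold p ⊆ σ.exec i k v
  /-- a spinning vertex does not execute -/
  spin_disjoint_exec : ∀ i k v p, σ.IssuedBy p i k v → Disjoint (σ.spin p) (σ.exec i k v)
  /-- locks are non-nested: a vertex completes a request before it issues another one -/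
  non_nested : ∀ i k v p p', σ.IssuedBy p i k v → σ.IssuedBy p' i k v → p ≠ p' →
    Disjoint (Set.Ico (σ.issue p) (σ.done p)) (Set.Ico (σ.issue p') (σ.done p'))
  /-- a job of task `i` accesses resource `q` at most `N i q` times -/
  access_count : ∀ i k q, {n : Fin (σ.numReq i k) | σ.res ⟨i, k, n⟩ = q}.ncard ≤ S.N i q
  /-- a single access of task `i` to resource `q` lasts at most `L i q` -/
  access_length : ∀ p : σ.Req, σ.done p - σ.acquire p ≤ S.L p.1 (σ.res p)
  mutual_exclusion : ∀ p p', p ≠ p' → σ.res p = σ.res p' → Disjoint (σ.hold p) (σ.hold p')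
  /-- a vertex spins only while the lock is held by another vertex -/
  held_of_spin : ∀ p, ∀ t ∈ σ.spin p, ∃ p', p' ≠ p ∧ σ.res p' = σ.res p ∧ t ∈ σ.hold p'

/-- Requests for the same resource are served in FIFO order (ties are broken arbitrarily). -/
def IsFIFO : Prop :=
  ∀ p p', σ.res p = σ.res p' → σ.issue p < σ.issue p' → σ.acquire p < σ.acquire p'

/-- Response time of job `k` of task `i`; the job finishes when its tail vertex does. -/
def responseTime (i : ι) (k : ℕ) : ℝ := σ.finish i k (S.tail i) - σ.release i k

/-- Worst-case response time of task `i`: the supremum over its jobs (possibly `⊤`). -/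
noncomputable def wcrt (i : ι) : EReal := ⨆ k, (σ.responseTime i k : EReal)

/-- Task `i` meets all its deadlines. -/
def Schedulable (i : ι) : Prop := σ.wcrt i ≤ (S.deadline i : EReal)

end Schedule

/-! Follow a critical path backwards from the tail, always to the predecessor that finishes last: at
every time before the job ends, exactly one vertex of this path `P` is pending. Each of the `m`
processors is then accounted for. If that vertex executes, at most `m - 1` processors are wasted. If
it is not busy, work conservation makes all `m` processors execute or spin for this job. If it spins
for `q`, every non-executing processor is charged to `q`. This is `IsLegal.m_le`, where `lost` is
the charge to a resource; integrated, it gives `C + (m - 1) * longestPath` plus the integrals of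
`lost`.

Processors are lost for `q` only while some request holds `q`, so the integral is split by holder.
Let `x` be the number of requests for `q` issued by `P`. An own holder on `P` costs nothing and one
off `P` at most `m - 1` processors. If `x = 0`, FIFO allows a finer count of pairs (holder,
spinner), which yields the correction `Delta`. A request of another task costs at most `m`
processors; alternatively, each own request waits for at most `m_j` requests of task `j`, where a
request of `P` weighs `m` and any other weighs `1`. As `x` is unknown, the bound takes a maximum.

The number of contending jobs is controlled by deadlines: they are released after `r - D_j` and
before `r + D_i`, with `r` the release of the job. If only the bounds are known to meet the
deadlines, the same estimate is applied up to the earliest missed deadline, where unfinished work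
makes it strict: a contradiction. -/

open scoped Classical

/-! ### Counting lemmas -/

/-- If `r` is a relation that increases `f` and every element has at most `M` predecessors, then
`r` has at most `∑ l < n, min l M` pairs on a set of `n` elements. -/
theorem Finset.sum_card_pred_le {α : Type*} (s : Finset α) (f : α → ℝ) (r : α → α → Prop) (M : ℕ)
    (hr : ∀ a ∈ s, ∀ b ∈ s, r a b → f a < f b)
    (hM : ∀ b ∈ s, (s.filter (fun a => r a b)).card ≤ M) :
    ∑ b ∈ s, (s.filter (fun a => r a b)).card ≤ ∑ l ∈ Finset.range s.card, min l M := by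
  -- An element of maximal `f` precedes nothing, so removing it changes no other predecessor set,
  -- and its own predecessors lie in the remaining set.
  induction s using Finset.induction_on_max_value f with
  | empty => simp
  | insert a s ha hmax ih =>
    have hsub : ∀ b ∈ s, (insert a s).filter (fun x => r x b) = s.filter (fun x => r x b) := by
      intro b hb
      rw [Finset.filter_insert, if_neg]
      intro h
      exact absurd (hr a (by simp) b (by simp [hb]) h) (not_lt.2 (hmax b hb))
    have haa : (insert a s).filter (fun x => r x a) = s.filter (fun x => r x a) := by
      rw [Finset.filter_insert, if_neg]
      intro h
      exact lt_irrefl _ (hr a (by simp) a (by simp) h)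
    rw [Finset.sum_insert ha, Finset.card_insert_of_notMem ha, Finset.sum_range_succ, add_comm]
    refine add_le_add ?_ (le_min ?_ ?_)
    · rw [Finset.sum_congr rfl fun b hb => by rw [hsub b hb]]
      refine ih (fun x hx y hy => hr x (by simp [hx]) y (by simp [hy])) fun b hb => ?_
      rw [← hsub b hb]
      exact hM b (by simp [hb])
    · rw [haa]
      exact Finset.card_filter_le _ _
    · exact hM a (by simp)

/-- The subtracted term is `Delta`: the deficit `∑ (m - 1 - l)` over `l < min N m` of the summands
relative to the constant `m - 1`. -/
theorem sum_range_min_eq (N m : ℕ) (hm : 0 < m) :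
    ((∑ l ∈ Finset.range N, min l (m - 1) : ℕ) : ℝ) =
      N * ((m : ℝ) - 1) - min (N : ℝ) m * ((m : ℝ) - (min (N : ℝ) m + 1) / 2) := by
  induction N with
  | zero => simp
  | succ n ih =>
    rw [Finset.sum_range_succ, Nat.cast_add, ih]
    rcases Nat.lt_or_ge n m with h | h
    · have h1 : (n : ℝ) ≤ m := by exact_mod_cast h.le
      have h2 : ((n + 1 : ℕ) : ℝ) ≤ m := by exact_mod_cast h
      rw [min_eq_left h1, min_eq_left h2, min_eq_left (by omega : n ≤ m - 1)]
      push_cast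
      ring
    · have h1 : (m : ℝ) ≤ n := by exact_mod_cast h
      have h2 : (m : ℝ) ≤ ((n + 1 : ℕ) : ℝ) := by exact_mod_cast h.trans (Nat.le_succ n)
      rw [min_eq_right h1, min_eq_right h2, min_eq_right (by omega : m - 1 ≤ n),
        Nat.cast_pred hm]
      push_cast
      ring

/-- An open interval contains at most `⌈(b - a) / T⌉` terms of a `T`-separated sequence. -/
theorem exists_finset_of_separated (f : ℕ → ℝ) {T a b : ℝ} (hT : 0 < T)
    (hf : ∀ n, f n + T ≤ f (n + 1)) :
    ∃ s : Finset ℕ, (∀ n, a < f n → f n < b → n ∈ s) ∧ s.card ≤ ⌈(b - a) / T⌉₊ := by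
  by_cases h : ∃ n, a < f n
  · have hsep : ∀ n l : ℕ, f n + l * T ≤ f (n + l) := by
      intro n l
      induction l with
      | zero => simp
      | succ l ih =>
        have := hf (n + l)
        rw [← add_assoc]
        push_cast
        linarith
    -- Counting starts at the first term beyond `a`; the `l`-th term after it exceeds `a + l * T`,
    -- so lying below `b` forces `l < (b - a) / T`.
    refine ⟨Finset.Ico (Nat.find h) (Nat.find h + ⌈(b - a) / T⌉₊), fun n hn hnb => ?_, by simp⟩
    have hle : Nat.find h ≤ n := Nat.find_min' h hn
    obtain ⟨l, rfl⟩ := Nat.exists_eq_add_of_le hle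
    have h1 := hsep (Nat.find h) l
    have h2 := Nat.find_spec h
    rw [Finset.mem_Ico]
    refine ⟨hle, Nat.add_lt_add_left (Nat.lt_ceil.2 ?_) _⟩
    rw [lt_div_iff₀ hT]
    linarith
  · exact ⟨∅, fun n hn => absurd ⟨n, hn⟩ h, by simp⟩

/-! ### Paths in the DAG of a task -/

namespace TaskSystem

variable {ι : Type*} {ρ : Type*} (S : TaskSystem ι ρ)

theorem period_pos (i : ι) : 0 < S.period i := (S.deadline_pos i).trans_le (S.deadline_le_period i)

theorem wellFounded_E (i : ι) : WellFounded (S.E i) := by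
  have : IsTrans (S.V i) (Relation.TransGen (S.E i)) := ⟨fun _ _ _ => Relation.TransGen.trans⟩
  have : Std.Irrefl (Relation.TransGen (S.E i)) := ⟨S.acyclic i⟩
  exact Subrelation.wf (fun h => Relation.TransGen.single h)
    (Finite.wellFounded_of_trans_of_irrefl (Relation.TransGen (S.E i)))

theorem wellFounded_E_swap (i : ι) : WellFounded (fun u v => S.E i v u) := by
  have : IsTrans (S.V i) (fun u v => Relation.TransGen (S.E i) v u) :=
    ⟨fun _ _ _ h h' => Relation.TransGen.trans h' h⟩
  have : Std.Irrefl (fun u v => Relation.TransGen (S.E i) v u) := ⟨S.acyclic i⟩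
  exact Subrelation.wf (fun h => Relation.TransGen.single h)
    (Finite.wellFounded_of_trans_of_irrefl (fun u v => Relation.TransGen (S.E i) v u))

theorem pairwise_of_isChain {i : ι} {l : List (S.V i)} (hl : l.IsChain (S.E i)) :
    l.Pairwise (Relation.TransGen (S.E i)) := by
  have : IsTrans (S.V i) (Relation.TransGen (S.E i)) := ⟨fun _ _ _ => Relation.TransGen.trans⟩
  exact List.isChain_iff_pairwise.1 (hl.imp fun _ _ h => Relation.TransGen.single h)

theorem nodup_of_isChain {i : ι} {l : List (S.V i)} (hl : l.IsChain (S.E i)) : l.Nodup :=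
  (S.pairwise_of_isChain hl).imp fun {a b} h => by
    rintro rfl
    exact S.acyclic i a h

theorem sum_le_longestPath {i : ι} {l : List (S.V i)} (hl : S.IsCompletePath i l) :
    ∑ v ∈ l.toFinset, S.c i v ≤ S.longestPath i := by
  have hsum : ∀ l', S.IsCompletePath i l' → (l'.map (S.c i)).sum = ∑ v ∈ l'.toFinset, S.c i v :=
    fun l' h' => (List.sum_toFinset _ (S.nodup_of_isChain h'.1)).symm
  rw [← hsum l hl]
  refine le_csSup ⟨∑ v, S.c i v, ?_⟩ ⟨l, hl, rfl⟩
  rintro _ ⟨l', h', rfl⟩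
  rw [hsum l' h']
  exact Finset.sum_le_sum_of_subset_of_nonneg (Finset.subset_univ _) fun v _ _ => S.c_nonneg i v

end TaskSystem

/-! ### Pending vertices and the critical path -/

namespace Schedule

variable {ι : Type*} {ρ : Type*} {S : TaskSystem ι ρ} {σ : Schedule S}

theorem IsLegal.finish_le_of_edge (hσ : σ.IsLegal) {i : ι} {u v : S.V i} (k : ℕ)
    (h : S.E i u v) : σ.finish i k u ≤ σ.finish i k v :=
  (hσ.finish_isLeast i k v).1.2.1 u h

theorem IsLegal.finish_le_of_pending (hσ : σ.IsLegal) {i : ι} {k : ℕ} {u v : S.V i} {τ : ℝ}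
    (h : Relation.TransGen (S.E i) u v) (hv : σ.Pending i k v τ) : σ.finish i k u ≤ τ := by
  induction h using Relation.TransGen.head_induction_on with
  | single h => exact hv.2.1 _ h
  | head h _ ih => exact (hσ.finish_le_of_edge k h).trans ih

theorem IsLegal.finish_le_tail (hσ : σ.IsLegal) (i : ι) (k : ℕ) (v : S.V i) :
    σ.finish i k v ≤ σ.finish i k (S.tail i) := by
  induction v using (S.wellFounded_E_swap i).induction with
  | _ v ih =>
    by_cases hv : v = S.tail i
    · rw [hv]
    · have := mt (S.tail_iff i v).1 hv
      push Not at this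
      obtain ⟨u, hu⟩ := this
      exact (hσ.finish_le_of_edge k hu).trans (ih u hu)

theorem IsLegal.lt_finish_of_busy (hσ : σ.IsLegal) {i : ι} {k : ℕ} {v : S.V i} {τ : ℝ}
    (h : σ.Busy i k v τ) : σ.release i k ≤ τ ∧ τ < σ.finish i k (S.tail i) :=
  have hp := hσ.pending_of_busy i k v τ h
  ⟨hp.1, hp.2.2.trans_le (hσ.finish_le_tail i k v)⟩

/-- The critical path: at any time before the end of the job, one of its vertices is pending. -/
theorem exists_path_to (σ : Schedule S) (i : ι) (k : ℕ) (v : S.V i) :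
    ∃ l : List (S.V i), l.IsChain (S.E i) ∧ l.head? = some (S.head i) ∧ l.getLast? = some v ∧
      ∀ τ, σ.release i k ≤ τ → τ < σ.finish i k v → ∃ u ∈ l, σ.Pending i k u τ := by
  induction v using (S.wellFounded_E i).induction with
  | _ v ih =>
    by_cases hv : v = S.head i
    · subst hv
      refine ⟨[S.head i], by simp, by simp, by simp, fun τ h1 h2 => ⟨_, by simp, h1, ?_, h2⟩⟩
      intro u hu
      exact absurd hu ((S.head_iff i _).2 rfl u)
    · have hne := mt (S.head_iff i v).1 hv
      push Not at hne
      obtain ⟨u₀, hu₀⟩ := hne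
      -- With `u` the last predecessor to finish, the path to `u` serves until `u` finishes, and
      -- from then on `v` itself is pending.
      obtain ⟨u, hu, hmax⟩ := Finset.exists_max_image
        (Finset.univ.filter fun u => S.E i u v) (σ.finish i k) ⟨u₀, by simpa using hu₀⟩
      simp only [Finset.mem_filter, Finset.mem_univ, true_and] at hu hmax
      obtain ⟨l, hc, hh, hlast, hp⟩ := ih u hu
      refine ⟨l ++ [v], ?_, ?_, by simp, fun τ h1 h2 => ?_⟩
      · rw [List.isChain_append]
        refine ⟨hc, by simp, ?_⟩
        intro x hx y hy
        rw [hlast] at hx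
        simp only [Option.mem_def, Option.some.injEq, List.head?_cons] at hx hy
        exact hx ▸ hy ▸ hu
      · rw [List.head?_append, hh]
        rfl
      · rcases lt_or_ge τ (σ.finish i k u) with h | h
        · obtain ⟨w, hw, hw'⟩ := hp τ h1 h
          exact ⟨w, by simp [hw], hw'⟩
        · exact ⟨v, by simp, h1, fun w hw => (hmax w hw).trans h, h2⟩

/-- Any two vertices of a chain are comparable, and the earlier one must be finished before the
later one is pending. -/
theorem IsLegal.eq_of_pending (hσ : σ.IsLegal) {i : ι} {k : ℕ} {l : List (S.V i)}
    (hl : l.IsChain (S.E i)) {u v : S.V i} (hu : u ∈ l) (hv : v ∈ l) {τ : ℝ}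
    (hpu : σ.Pending i k u τ) (hpv : σ.Pending i k v τ) : u = v := by
  have key : ∀ x ∈ l, ∀ y ∈ l, x = y ∨
      Relation.TransGen (S.E i) x y ∨ Relation.TransGen (S.E i) y x := by
    have hpw := S.pairwise_of_isChain hl
    have := (hpw.imp (S := fun x y => x = y ∨
      Relation.TransGen (S.E i) x y ∨ Relation.TransGen (S.E i) y x) fun h => Or.inr (Or.inl h))
    intro x hx y hy
    have hs : Std.Symm (fun x y => x = y ∨
        Relation.TransGen (S.E i) x y ∨ Relation.TransGen (S.E i) y x) := ⟨by
      rintro a b (h | h | h)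
      exacts [Or.inl h.symm, Or.inr (Or.inr h), Or.inr (Or.inl h)]⟩
    refine List.Pairwise.forall_of_forall ?_ this hx hy
    exact fun _ _ => Or.inl rfl
  rcases key u hu v hv with h | h | h
  · exact h
  · exact absurd (hσ.finish_le_of_pending h hpv) (not_le.2 hpu.2.2)
  · exact absurd (hσ.finish_le_of_pending h hpu) (not_le.2 hpv.2.2)

/-- A pending vertex has some of its execution time left. -/
theorem IsLegal.volume_exec_lt (hσ : σ.IsLegal) {i : ι} {k : ℕ} {v : S.V i} {τ : ℝ}
    (h : σ.Pending i k v τ) :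
    volume (σ.exec i k v ∩ Set.Iio τ) < ENNReal.ofReal (σ.work i k v) := by
  obtain ⟨⟨-, -, hw, hd⟩, hleast⟩ := hσ.finish_isLeast i k v
  have hle : volume (σ.exec i k v ∩ Set.Iio τ) ≤ ENNReal.ofReal (σ.work i k v) := by
    rw [← hw]
    exact measure_mono (Set.inter_subset_inter_right _ (Set.Iio_subset_Iio h.2.2.le))
  refine lt_of_le_of_ne hle fun heq => ?_
  -- Were the work complete at `τ`, minimality of the finish time would leave some request
  -- incomplete; its lock holding after `τ` would be execution in excess of the work.
  have hnot : ¬ ∀ p, σ.IssuedBy p i k v → σ.done p ≤ τ := fun hall =>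
    absurd (hleast ⟨h.1, h.2.1, heq, hall⟩) (not_le.2 h.2.2)
  push Not at hnot
  obtain ⟨p, hp, hpt⟩ := hnot
  have hlt : max (σ.acquire p) τ < σ.done p := max_lt (hσ.acquire_lt_done p) hpt
  have hsub : (σ.exec i k v ∩ Set.Iio τ) ∪ Set.Ico (max (σ.acquire p) τ) (σ.done p) ⊆
      σ.exec i k v ∩ Set.Iio (σ.finish i k v) := by
    rintro x (⟨hx, hx'⟩ | ⟨hx, hx'⟩)
    · exact ⟨hx, lt_trans hx' h.2.2⟩
    · exact ⟨hσ.hold_subset_exec i k v p hp ⟨(le_max_left _ _).trans hx, hx'⟩,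
        hx'.trans_le (hd p hp)⟩
  have hdisj : Disjoint (σ.exec i k v ∩ Set.Iio τ)
      (Set.Ico (max (σ.acquire p) τ) (σ.done p)) := by
    rw [Set.disjoint_left]
    rintro x ⟨-, hx⟩ ⟨hx', -⟩
    exact absurd ((le_max_right _ _).trans hx') (not_le.2 hx)
  have hm := measure_mono (μ := volume) hsub
  rw [measure_union hdisj measurableSet_Ico, hw, heq, Real.volume_Ico] at hm
  have hpos : 0 < ENNReal.ofReal (σ.done p - max (σ.acquire p) τ) :=
    ENNReal.ofReal_pos.2 (sub_pos.2 hlt)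
  exact absurd hm (not_le.2 (ENNReal.lt_add_right ENNReal.ofReal_ne_top hpos.ne'))

end Schedule

/-! ### Lock requests and busy processors -/

namespace Schedule

variable {ι : Type*} {ρ : Type*} {S : TaskSystem ι ρ} {σ : Schedule S}

theorem issuedBy_mk (σ : Schedule S) (i : ι) (y : Σ k, Fin (σ.numReq i k)) :
    σ.IssuedBy ⟨i, y⟩ i y.1 (σ.vertex ⟨i, y⟩) :=
  ⟨y.2, rfl, rfl⟩

theorem IsLegal.busy_of_mem (hσ : σ.IsLegal) {i : ι} {y : Σ k, Fin (σ.numReq i k)} {τ : ℝ}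
    (h : τ ∈ Set.Ico (σ.issue ⟨i, y⟩) (σ.done ⟨i, y⟩)) :
    σ.Busy i y.1 (σ.vertex ⟨i, y⟩) τ := by
  rcases lt_or_ge τ (σ.acquire ⟨i, y⟩) with h' | h'
  · exact Or.inr ⟨_, σ.issuedBy_mk i y, h.1, h'⟩
  · exact Or.inl (hσ.hold_subset_exec _ _ _ _ (σ.issuedBy_mk i y) ⟨h', h.2⟩)

theorem IsLegal.spin_subset (hσ : σ.IsLegal) (p : σ.Req) :
    σ.spin p ⊆ Set.Ico (σ.issue p) (σ.done p) :=
  Set.Ico_subset_Ico_right (hσ.acquire_lt_done p).le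

theorem IsLegal.hold_subset (hσ : σ.IsLegal) (p : σ.Req) :
    σ.hold p ⊆ Set.Ico (σ.issue p) (σ.done p) :=
  Set.Ico_subset_Ico_left (hσ.issue_le_acquire p)

/-- A vertex has at most one incomplete request at a time. -/
theorem IsLegal.eq_of_vertex_eq (hσ : σ.IsLegal) {i : ι} {y y' : Σ k, Fin (σ.numReq i k)} {τ : ℝ}
    (h : τ ∈ Set.Ico (σ.issue ⟨i, y⟩) (σ.done ⟨i, y⟩))
    (h' : τ ∈ Set.Ico (σ.issue ⟨i, y'⟩) (σ.done ⟨i, y'⟩)) (hk : y.1 = y'.1)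
    (hv : σ.vertex ⟨i, y⟩ = σ.vertex ⟨i, y'⟩) : y = y' := by
  obtain ⟨k, n⟩ := y
  obtain ⟨k', n'⟩ := y'
  obtain rfl : k = k' := hk
  by_contra hne
  refine Set.disjoint_left.1 (hσ.non_nested i k (σ.vertex ⟨i, k, n⟩) ⟨i, k, n⟩ ⟨i, k, n'⟩
    ⟨n, rfl, rfl⟩ ⟨n', rfl, hv.symm⟩ ?_) h h'
  intro heq
  exact hne (eq_of_heq (Sigma.mk.inj heq).2)

/-- A task has at most as many incomplete requests as processors. -/
theorem IsLegal.card_incomplete_le (hσ : σ.IsLegal) {i : ι} {τ : ℝ}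
    (s : Finset (Σ k, Fin (σ.numReq i k)))
    (hs : ∀ y ∈ s, τ ∈ Set.Ico (σ.issue ⟨i, y⟩) (σ.done ⟨i, y⟩)) : s.card ≤ S.m i := by
  let f : (Σ k, Fin (σ.numReq i k)) → ℕ × S.V i := fun y => (y.1, σ.vertex ⟨i, y⟩)
  have hinj : Set.InjOn f s := fun y hy y' hy' h =>
    hσ.eq_of_vertex_eq (hs y hy) (hs y' hy') (congrArg Prod.fst h) (congrArg Prod.snd h)
  have hsub : ((s.image f : Finset (ℕ × S.V i)) : Set (ℕ × S.V i)) ⊆ σ.busySet i τ := by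
    intro a ha
    obtain ⟨y, hy, rfl⟩ := Finset.mem_image.1 (Finset.mem_coe.1 ha)
    exact hσ.busy_of_mem (hs y hy)
  have := (Set.encard_le_encard hsub).trans (hσ.capacity i τ)
  rw [Set.encard_coe_eq_coe_finsetCard, Finset.card_image_of_injOn hinj] at this
  exact_mod_cast this

/-- Under FIFO, the requests a request waits for are incomplete when it is issued. -/
theorem issue_mem_of_inter (hfifo : σ.IsFIFO) {p p' : σ.Req}
    (hres : σ.res p' = σ.res p) (h : (σ.hold p' ∩ σ.spin p).Nonempty) :
    σ.issue p ∈ Set.Ico (σ.issue p') (σ.done p') ∧ σ.acquire p' < σ.acquire p ∧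
      σ.issue p < σ.acquire p := by
  obtain ⟨τ, ⟨h1, h2⟩, h3, h4⟩ := h
  refine ⟨⟨?_, h3.trans_lt h2⟩, h1.trans_lt h4, h3.trans_lt h4⟩
  by_contra hlt
  have := hfifo p p' hres.symm (not_le.1 hlt)
  linarith

/-- The requests of a job for a resource. -/
noncomputable def jobReq (σ : Schedule S) (i : ι) (k : ℕ) (q : ρ) : Finset (Fin (σ.numReq i k)) :=
  Finset.univ.filter fun n => σ.res ⟨i, k, n⟩ = q

theorem mem_jobReq {i : ι} {k : ℕ} {q : ρ} {n : Fin (σ.numReq i k)} :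
    n ∈ σ.jobReq i k q ↔ σ.res ⟨i, k, n⟩ = q := by
  simp [jobReq]

theorem IsLegal.card_jobReq_le (hσ : σ.IsLegal) (i : ι) (k : ℕ) (q : ρ) :
    (σ.jobReq i k q).card ≤ S.N i q := by
  have := hσ.access_count i k q
  rwa [show {n : Fin (σ.numReq i k) | σ.res ⟨i, k, n⟩ = q} = (σ.jobReq i k q : Set _) by
    ext n; simp [mem_jobReq], Set.ncard_coe_finset] at this

/-- Number of executing vertices of a job. -/
noncomputable def execCount (σ : Schedule S) (i : ι) (k : ℕ) (τ : ℝ) : ℝ :=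
  ∑ v, (σ.exec i k v).indicator 1 τ

/-- Number of requests of a job spinning for a resource. -/
noncomputable def spinCount (σ : Schedule S) (i : ι) (k : ℕ) (q : ρ) (τ : ℝ) : ℝ :=
  ∑ n ∈ σ.jobReq i k q, (σ.spin ⟨i, k, n⟩).indicator 1 τ

theorem execCount_nonneg (i : ι) (k : ℕ) (τ : ℝ) : 0 ≤ σ.execCount i k τ :=
  Finset.sum_nonneg fun _ _ => Set.indicator_nonneg (fun _ _ => zero_le_one) _

theorem spinCount_nonneg (i : ι) (k : ℕ) (q : ρ) (τ : ℝ) : 0 ≤ σ.spinCount i k q τ :=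
  Finset.sum_nonneg fun _ _ => Set.indicator_nonneg (fun _ _ => zero_le_one) _

theorem one_le_execCount {i : ι} {k : ℕ} {v : S.V i} {τ : ℝ} (h : τ ∈ σ.exec i k v) :
    1 ≤ σ.execCount i k τ := by
  have := Finset.single_le_sum (f := fun v => (σ.exec i k v).indicator (1 : ℝ → ℝ) τ)
    (fun _ _ => Set.indicator_nonneg (fun _ _ => zero_le_one) _) (Finset.mem_univ v)
  simpa [Set.indicator_of_mem h, execCount] using this

theorem sum_indicator_eq_card {α : Type*} (s : Finset α) (A : α → Set ℝ) (τ : ℝ) :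
    ∑ a ∈ s, (A a).indicator (1 : ℝ → ℝ) τ = (s.filter fun a => τ ∈ A a).card := by
  rw [Finset.card_filter]
  push_cast
  exact Finset.sum_congr rfl fun a _ => by simp [Set.indicator_apply]

/-- Non-nesting makes spinning requests correspond injectively to spinning vertices, and these do
not execute, so no busy vertex is counted twice. -/
theorem IsLegal.execCount_add_spin (hσ : σ.IsLegal) (i : ι) (k : ℕ) (τ : ℝ) :
    σ.execCount i k τ + ∑ n, (σ.spin ⟨i, k, n⟩).indicator (1 : ℝ → ℝ) τ =
      (Finset.univ.filter fun v => σ.Busy i k v τ).card := by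
  let f : Fin (σ.numReq i k) → S.V i := fun n => σ.vertex ⟨i, k, n⟩
  have hinj : Set.InjOn f
      (Finset.univ.filter fun n : Fin (σ.numReq i k) => τ ∈ σ.spin ⟨i, k, n⟩) := by
    intro n hn n' hn' h
    have := hσ.eq_of_vertex_eq (y := ⟨k, n⟩) (y' := ⟨k, n'⟩)
      (hσ.spin_subset _ (by simpa using hn)) (hσ.spin_subset _ (by simpa using hn')) rfl h
    exact eq_of_heq (Sigma.mk.inj this).2
  have hdisj : Disjoint (Finset.univ.filter fun v => τ ∈ σ.exec i k v)
      ((Finset.univ.filter fun n : Fin (σ.numReq i k) => τ ∈ σ.spin ⟨i, k, n⟩).image f) := by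
    rw [Finset.disjoint_left]
    intro v hv hv'
    obtain ⟨n, hn, rfl⟩ := Finset.mem_image.1 hv'
    exact Set.disjoint_left.1 (hσ.spin_disjoint_exec i k _ ⟨i, k, n⟩ ⟨n, rfl, rfl⟩)
      (by simpa using hn) (by simpa using hv)
  rw [execCount, sum_indicator_eq_card, sum_indicator_eq_card, ← Nat.cast_add,
    ← Finset.card_image_of_injOn hinj, ← Finset.card_union_of_disjoint hdisj]
  congr 2
  ext v
  simp only [Finset.mem_union, Finset.mem_filter, Finset.mem_univ, true_and, Finset.mem_image]
  refine or_congr Iff.rfl ⟨?_, ?_⟩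
  · rintro ⟨n, hn, rfl⟩
    exact ⟨_, ⟨n, rfl, rfl⟩, hn⟩
  · rintro ⟨p, ⟨n, rfl, hv⟩, hp⟩
    exact ⟨n, hp, hv⟩

theorem image_busy_subset (i : ι) (k : ℕ) (τ : ℝ) :
    (((Finset.univ.filter fun v => σ.Busy i k v τ).image fun v => (k, v) :
      Finset (ℕ × S.V i)) : Set (ℕ × S.V i)) ⊆ σ.busySet i τ := by
  intro a ha
  obtain ⟨v, hv, rfl⟩ := Finset.mem_image.1 (Finset.mem_coe.1 ha)
  simpa [busySet] using hv

theorem IsLegal.card_busy_le (hσ : σ.IsLegal) (i : ι) (k : ℕ) (τ : ℝ) :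
    (Finset.univ.filter fun v => σ.Busy i k v τ).card ≤ S.m i := by
  have := (Set.encard_le_encard (σ.image_busy_subset i k τ)).trans (hσ.capacity i τ)
  rw [Set.encard_coe_eq_coe_finsetCard,
    Finset.card_image_of_injective _ (Prod.mk_right_injective k)] at this
  exact_mod_cast this

/-- Work conservation counts vertices of all jobs of the task; `hother` attributes all of them to
job `k`. -/
theorem IsLegal.card_busy_eq (hσ : σ.IsLegal) {i : ι} {k : ℕ} {τ : ℝ} {v : S.V i}
    (hother : ∀ k' u, σ.Busy i k' u τ → k' = k) (hp : σ.Pending i k v τ)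
    (hb : ¬ σ.Busy i k v τ) :
    (Finset.univ.filter fun v => σ.Busy i k v τ).card = S.m i := by
  have hsub : σ.busySet i τ ⊆ (((Finset.univ.filter fun v => σ.Busy i k v τ).image
      fun v => (k, v) : Finset (ℕ × S.V i)) : Set (ℕ × S.V i)) := by
    rintro ⟨k', u⟩ (hu : σ.Busy i k' u τ)
    obtain rfl := hother k' u hu
    simpa using hu
  have := hσ.work_conserving i k v τ hp hb
  rw [hsub.antisymm (σ.image_busy_subset i k τ), Set.encard_coe_eq_coe_finsetCard,
    Finset.card_image_of_injective _ (Prod.mk_right_injective k)] at this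
  exact_mod_cast this

theorem IsLegal.execCount_add_spinCount_le (hσ : σ.IsLegal) (i : ι) (k : ℕ) (q : ρ) (τ : ℝ) :
    σ.execCount i k τ + σ.spinCount i k q τ ≤ S.m i := by
  have h1 : (_ : ℝ) ≤ S.m i := Nat.cast_le.2 (hσ.card_busy_le i k τ)
  rw [← hσ.execCount_add_spin] at h1
  refine le_trans (add_le_add le_rfl ?_) h1
  exact Finset.sum_le_sum_of_subset_of_nonneg (Finset.subset_univ _) fun _ _ _ =>
    Set.indicator_nonneg (fun _ _ => zero_le_one) _

theorem IsLegal.sum_spinCount [Fintype ρ] (hσ : σ.IsLegal) (i : ι) (k : ℕ) (τ : ℝ) :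
    ∑ q ∈ Finset.univ.filter (fun q => 0 < S.N i q), σ.spinCount i k q τ =
      ∑ n, (σ.spin ⟨i, k, n⟩).indicator (1 : ℝ → ℝ) τ := by
  rw [← Finset.sum_fiberwise (s := Finset.univ) (g := fun n => σ.res ⟨i, k, n⟩)]
  refine Finset.sum_subset (Finset.subset_univ _) fun q _ hq => ?_
  have hN : S.N i q = 0 := by simpa using hq
  have := hσ.card_jobReq_le i k q
  rw [hN, Nat.le_zero, Finset.card_eq_zero] at this
  simp [spinCount, this]

/-! ### Processors lost by spinning -/

/-- Number of processors of a job lost by spinning for a resource: all processors that do not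
execute when a vertex of the path `P` spins for the resource, and those that spin for the resource
when no vertex of `P` is busy. -/
noncomputable def lost (σ : Schedule S) (i : ι) (k : ℕ) (P : Finset (S.V i)) (q : ρ) (τ : ℝ) : ℝ :=
  {τ | ∃ n ∈ σ.jobReq i k q, σ.vertex ⟨i, k, n⟩ ∈ P ∧ τ ∈ σ.spin ⟨i, k, n⟩}.indicator
      (fun τ => S.m i - σ.execCount i k τ) τ +
    {τ | ∀ v ∈ P, ¬ σ.Busy i k v τ}.indicator (σ.spinCount i k q) τ

variable {i : ι} {k : ℕ} {P : Finset (S.V i)} {q : ρ} {τ : ℝ}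

/-- A spinning vertex of the path is busy, so the two indicators in `lost` have disjoint supports.
-/
theorem lost_cases (σ : Schedule S) (i : ι) (k : ℕ) (P : Finset (S.V i)) (q : ρ) (τ : ℝ) :
    ((∃ n ∈ σ.jobReq i k q, σ.vertex ⟨i, k, n⟩ ∈ P ∧ τ ∈ σ.spin ⟨i, k, n⟩) ∧
      σ.lost i k P q τ = S.m i - σ.execCount i k τ) ∨
    ((∀ v ∈ P, ¬ σ.Busy i k v τ) ∧ σ.lost i k P q τ = σ.spinCount i k q τ) ∨
    σ.lost i k P q τ = 0 := by
  by_cases h1 : ∃ n ∈ σ.jobReq i k q, σ.vertex ⟨i, k, n⟩ ∈ P ∧ τ ∈ σ.spin ⟨i, k, n⟩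
  · refine Or.inl ⟨h1, ?_⟩
    obtain ⟨n, hn, hv, hτ⟩ := id h1
    have h2 : ¬ ∀ v ∈ P, ¬ σ.Busy i k v τ := fun h => h _ hv (Or.inr ⟨_, ⟨n, rfl, rfl⟩, hτ⟩)
    rw [lost, Set.indicator_of_mem (by exact h1), Set.indicator_of_notMem (by exact h2), add_zero]
  · by_cases h2 : ∀ v ∈ P, ¬ σ.Busy i k v τ
    · refine Or.inr (Or.inl ⟨h2, ?_⟩)
      rw [lost, Set.indicator_of_notMem (by exact h1), Set.indicator_of_mem (by exact h2), zero_add]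
    · refine Or.inr (Or.inr ?_)
      rw [lost, Set.indicator_of_notMem (by exact h1), Set.indicator_of_notMem (by exact h2),
        add_zero]

theorem IsLegal.lost_nonneg (hσ : σ.IsLegal) : 0 ≤ σ.lost i k P q τ := by
  have h1 := hσ.execCount_add_spinCount_le i k q τ
  have h2 := σ.spinCount_nonneg i k q τ
  rcases σ.lost_cases i k P q τ with ⟨-, h⟩ | ⟨-, h⟩ | h <;> rw [h] <;> linarith

/-- Spinning and executing processors are disjoint. While an own request holds a lock its vertex
executes, so this gives the bound `m - 1`. -/
theorem IsLegal.lost_le_sub (hσ : σ.IsLegal) : σ.lost i k P q τ ≤ S.m i - σ.execCount i k τ := by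
  have h1 := hσ.execCount_add_spinCount_le i k q τ
  have h2 := σ.spinCount_nonneg i k q τ
  rcases σ.lost_cases i k P q τ with ⟨-, h⟩ | ⟨-, h⟩ | h <;> rw [h] <;> linarith

theorem IsLegal.lost_le (hσ : σ.IsLegal) : σ.lost i k P q τ ≤ S.m i := by
  have h1 := σ.execCount_nonneg i k τ
  have h2 := hσ.lost_le_sub (P := P) (q := q) (i := i) (k := k) (τ := τ)
  linarith

/-- Together with `held_of_spin`, this confines the loss to times at which the resource is held. -/
theorem exists_spin_of_lost_ne_zero (h : σ.lost i k P q τ ≠ 0) :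
    ∃ n ∈ σ.jobReq i k q, τ ∈ σ.spin ⟨i, k, n⟩ := by
  rcases σ.lost_cases i k P q τ with ⟨⟨n, hn, -, hτ⟩, -⟩ | ⟨-, h'⟩ | h'
  · exact ⟨n, hn, hτ⟩
  · rw [h'] at h
    obtain ⟨n, hn, hne⟩ := Finset.exists_ne_zero_of_sum_ne_zero h
    exact ⟨n, hn, Set.mem_of_indicator_ne_zero hne⟩
  · exact absurd h' h

/-- The lost processors are accounted for by the spinning requests, those of the path having
weight `m`. -/
theorem lost_le_sum (σ : Schedule S) (i : ι) (k : ℕ) (P : Finset (S.V i)) (q : ρ) (τ : ℝ) :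
    σ.lost i k P q τ ≤ ∑ n ∈ σ.jobReq i k q,
      (if σ.vertex ⟨i, k, n⟩ ∈ P then (S.m i : ℝ) else 1) *
        (σ.spin ⟨i, k, n⟩).indicator (1 : ℝ → ℝ) τ := by
  have hm : (1 : ℝ) ≤ S.m i := by exact_mod_cast S.m_pos i
  have hnn : ∀ n ∈ σ.jobReq i k q, 0 ≤ (if σ.vertex ⟨i, k, n⟩ ∈ P then (S.m i : ℝ) else 1) *
        (σ.spin ⟨i, k, n⟩).indicator (1 : ℝ → ℝ) τ := fun n _ =>
    mul_nonneg (by split_ifs <;> positivity) (Set.indicator_nonneg (fun _ _ => zero_le_one) _)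
  rcases σ.lost_cases i k P q τ with ⟨⟨n, hn, hv, hτ⟩, h⟩ | ⟨-, h⟩ | h <;> rw [h]
  · refine le_trans ?_ (Finset.single_le_sum hnn hn)
    rw [if_pos hv, Set.indicator_of_mem hτ]
    have := σ.execCount_nonneg i k τ
    simpa using this
  · refine Finset.sum_le_sum fun n _ => ?_
    refine le_mul_of_one_le_left (Set.indicator_nonneg (fun _ _ => zero_le_one) _) ?_
    split_ifs
    exacts [hm, le_rfl]
  · exact Finset.sum_nonneg hnn

/-- Nothing is lost for a resource held by a vertex of the path. -/
theorem IsLegal.lost_eq_zero (hσ : σ.IsLegal)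
    (hP : ∀ u ∈ P, ∀ v ∈ P, ∀ τ, σ.Pending i k u τ → σ.Pending i k v τ → u = v)
    {n : Fin (σ.numReq i k)} (hn : σ.vertex ⟨i, k, n⟩ ∈ P) (hτ : τ ∈ σ.hold ⟨i, k, n⟩) :
    σ.lost i k P q τ = 0 := by
  have hex := hσ.hold_subset_exec i k _ ⟨i, k, n⟩ ⟨n, rfl, rfl⟩ hτ
  rcases σ.lost_cases i k P q τ with ⟨⟨n', hn', hv, hτ'⟩, -⟩ | ⟨h, -⟩ | h
  · have hsp : σ.Spinning i k (σ.vertex ⟨i, k, n'⟩) τ := ⟨_, ⟨n', rfl, rfl⟩, hτ'⟩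
    have heq := hP _ hn _ hv τ (hσ.pending_of_busy _ _ _ _ (Or.inl hex))
      (hσ.pending_of_busy _ _ _ _ (Or.inr hsp))
    refine absurd hex (Set.disjoint_left.1 (hσ.spin_disjoint_exec i k _ ⟨i, k, n'⟩
      ⟨n', rfl, heq.symm⟩) hτ')
  · exact absurd (Or.inl hex) (h _ hn)
  · exact h

theorem measurableSet_spin (p : σ.Req) : MeasurableSet (σ.spin p) := measurableSet_Ico

theorem measurableSet_hold (p : σ.Req) : MeasurableSet (σ.hold p) := measurableSet_Ico

theorem IsLegal.measurable_execCount (hσ : σ.IsLegal) (i : ι) (k : ℕ) :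
    Measurable (σ.execCount i k) :=
  Finset.measurable_fun_sum _ fun v _ => measurable_one.indicator (hσ.exec_measurable i k v)

theorem measurable_spinCount (σ : Schedule S) (i : ι) (k : ℕ) (q : ρ) :
    Measurable (σ.spinCount i k q) :=
  Finset.measurable_fun_sum _ fun _ _ => measurable_one.indicator (σ.measurableSet_spin _)

theorem IsLegal.measurableSet_busy (hσ : σ.IsLegal) (i : ι) (k : ℕ) (v : S.V i) :
    MeasurableSet {τ | σ.Busy i k v τ} := by
  have : {τ | σ.Busy i k v τ} = σ.exec i k v ∪
      ⋃ n : Fin (σ.numReq i k), ⋃ _ : σ.vertex ⟨i, k, n⟩ = v, σ.spin ⟨i, k, n⟩ := by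
    ext τ
    simp only [Busy, Spinning, Set.mem_ofPred_eq, Set.mem_union, Set.mem_iUnion, exists_prop]
    refine or_congr Iff.rfl ⟨?_, ?_⟩
    · rintro ⟨p, ⟨n, rfl, hv⟩, hp⟩
      exact ⟨n, hv, hp⟩
    · rintro ⟨n, hv, hn⟩
      exact ⟨_, ⟨n, rfl, hv⟩, hn⟩
  rw [this]
  exact (hσ.exec_measurable i k v).union (MeasurableSet.iUnion fun _ =>
    MeasurableSet.iUnion fun _ => σ.measurableSet_spin _)

theorem IsLegal.measurable_lost (hσ : σ.IsLegal) (i : ι) (k : ℕ) (P : Finset (S.V i)) (q : ρ) :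
    Measurable (σ.lost i k P q) := by
  refine Measurable.add (Measurable.indicator (measurable_const.sub (hσ.measurable_execCount i k))
    ?_) (Measurable.indicator (σ.measurable_spinCount i k q) ?_)
  · have : {τ | ∃ n ∈ σ.jobReq i k q, σ.vertex ⟨i, k, n⟩ ∈ P ∧ τ ∈ σ.spin ⟨i, k, n⟩} =
        ⋃ n : Fin (σ.numReq i k), ⋃ _ : n ∈ σ.jobReq i k q ∧ σ.vertex ⟨i, k, n⟩ ∈ P,
          σ.spin ⟨i, k, n⟩ := by
      ext τ
      simp [and_assoc]
    rw [this]
    exact MeasurableSet.iUnion fun _ => MeasurableSet.iUnion fun _ => σ.measurableSet_spin _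
  · have : {τ | ∀ v ∈ P, ¬ σ.Busy i k v τ} = ⋂ v ∈ P, {τ | σ.Busy i k v τ}ᶜ := by
      ext τ
      simp
    rw [this]
    exact Finset.measurableSet_biInter _ fun v _ => (hσ.measurableSet_busy i k v).compl

/-- Every processor executes, is left idle while the path executes, or is lost by spinning. -/
theorem IsLegal.m_le (hσ : σ.IsLegal) [Fintype ρ]
    (hother : ∀ k' u, σ.Busy i k' u τ → k' = k) (hpath : ∃ u ∈ P, σ.Pending i k u τ) :
    (S.m i : ℝ) ≤ σ.execCount i k τ +
      ((S.m i : ℝ) - 1) * ∑ v ∈ P, (σ.exec i k v).indicator (1 : ℝ → ℝ) τ +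
      ∑ q ∈ Finset.univ.filter (fun q => 0 < S.N i q), σ.lost i k P q τ := by
  have hm : (1 : ℝ) ≤ S.m i := by exact_mod_cast S.m_pos i
  have hex0 : 0 ≤ ∑ v ∈ P, (σ.exec i k v).indicator (1 : ℝ → ℝ) τ :=
    Finset.sum_nonneg fun _ _ => Set.indicator_nonneg (fun _ _ => zero_le_one) _
  have hlost0 : 0 ≤ ∑ q ∈ Finset.univ.filter (fun q => 0 < S.N i q), σ.lost i k P q τ :=
    Finset.sum_nonneg fun _ _ => hσ.lost_nonneg
  by_cases hbusy : ∀ v ∈ P, ¬ σ.Busy i k v τ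
  -- The pending path vertex is not busy, so all `m` processors are busy with this job, and the
  -- spinning ones are counted in `lost`.
  · obtain ⟨u, hu, hpu⟩ := hpath
    have hcard := hσ.card_busy_eq hother hpu (hbusy u hu)
    have h1 := hσ.execCount_add_spin i k τ
    rw [hcard, ← hσ.sum_spinCount] at h1
    have h2 : ∀ q, σ.lost i k P q τ = σ.spinCount i k q τ := by
      intro q
      have h3 : ¬ ∃ n ∈ σ.jobReq i k q, σ.vertex ⟨i, k, n⟩ ∈ P ∧ τ ∈ σ.spin ⟨i, k, n⟩ := by
        rintro ⟨n, -, hv, hτ⟩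
        exact hbusy _ hv (Or.inr ⟨_, ⟨n, rfl, rfl⟩, hτ⟩)
      rw [lost, Set.indicator_of_notMem (by exact h3), Set.indicator_of_mem (by exact hbusy),
        zero_add]
    simp only [h2]
    have := mul_nonneg (sub_nonneg.2 hm) hex0
    linarith
  · push Not at hbusy
    obtain ⟨v, hv, hex | ⟨p, ⟨n, rfl, hnv⟩, hτ⟩⟩ := hbusy
    -- A path vertex executes: `1 + (m - 1)` already reaches `m`.
    · have h1 := one_le_execCount hex
      have h2 : 1 ≤ ∑ v ∈ P, (σ.exec i k v).indicator (1 : ℝ → ℝ) τ := by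
        have := Finset.single_le_sum (f := fun v => (σ.exec i k v).indicator (1 : ℝ → ℝ) τ)
          (fun _ _ => Set.indicator_nonneg (fun _ _ => zero_le_one) _) hv
        simpa [Set.indicator_of_mem hex] using this
      nlinarith
    -- A path vertex spins: the loss for its resource alone comprises every processor that does not
    -- execute.
    · have hq : σ.res ⟨i, k, n⟩ ∈ Finset.univ.filter (fun q => 0 < S.N i q) := by
        simp only [Finset.mem_filter, Finset.mem_univ, true_and]
        exact (Finset.card_pos.2 ⟨n, mem_jobReq.2 rfl⟩).trans_le (hσ.card_jobReq_le i k _)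
      have h1 := Finset.single_le_sum (f := fun q => σ.lost i k P q τ)
        (fun _ _ => hσ.lost_nonneg) hq
      have h2 : σ.lost i k P (σ.res ⟨i, k, n⟩) τ = S.m i - σ.execCount i k τ := by
        have h3 : ∃ n' ∈ σ.jobReq i k (σ.res ⟨i, k, n⟩),
            σ.vertex ⟨i, k, n'⟩ ∈ P ∧ τ ∈ σ.spin ⟨i, k, n'⟩ :=
          ⟨n, mem_jobReq.2 rfl, hnv ▸ hv, hτ⟩
        have h4 : ¬ ∀ v ∈ P, ¬ σ.Busy i k v τ := fun h =>
          h v hv (Or.inr ⟨_, ⟨n, rfl, hnv⟩, hτ⟩)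
        rw [lost, Set.indicator_of_mem (by exact h3), Set.indicator_of_notMem (by exact h4),
          add_zero]
      have := mul_nonneg (sub_nonneg.2 hm) hex0
      simp only [h2] at h1
      linarith

end Schedule

/-! ### Processor time lost per resource -/

namespace Schedule

variable {ι : Type*} {ρ : Type*} {S : TaskSystem ι ρ} {σ : Schedule S}
variable {i : ι} {k : ℕ} {P : Finset (S.V i)} {q : ρ} {r t : ℝ}

theorem IsLegal.integrable_lost (hσ : σ.IsLegal) (μ : Measure ℝ) [IsFiniteMeasure μ] :
    Integrable (σ.lost i k P q) μ := by
  refine Integrable.of_bound (hσ.measurable_lost i k P q).aestronglyMeasurable (S.m i)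
    (Filter.Eventually.of_forall fun τ => ?_)
  rw [Real.norm_eq_abs, abs_of_nonneg hσ.lost_nonneg]
  exact hσ.lost_le

theorem IsLegal.measureReal_hold_le (hσ : σ.IsLegal) (p : σ.Req) :
    (volume.restrict (Set.Ico r t)).real (σ.hold p) ≤ S.L p.1 (σ.res p) := by
  refine le_trans ?_ (hσ.access_length p)
  have h : (volume : Measure ℝ).real (σ.hold p) = σ.done p - σ.acquire p := by
    rw [hold, Real.volume_real_Ico_of_le (hσ.acquire_lt_done p).le]
  rw [← h, measureReal_restrict_apply (σ.measurableSet_hold p)]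
  exact measureReal_mono Set.inter_subset_left (by rw [hold, Real.volume_Ico]; simp)

theorem IsLegal.integral_hold_le (hσ : σ.IsLegal) (p : σ.Req) {C : ℝ} (hC : 0 ≤ C)
    (h : ∀ τ ∈ σ.hold p, σ.lost i k P q τ ≤ C) :
    ∫ τ in σ.hold p, σ.lost i k P q τ ∂(volume.restrict (Set.Ico r t)) ≤
      C * S.L p.1 (σ.res p) := by
  refine (setIntegral_mono_on (hσ.integrable_lost _) (integrable_const C)
    (σ.measurableSet_hold p) h).trans ?_
  rw [setIntegral_const, smul_eq_mul, mul_comm]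
  exact mul_le_mul_of_nonneg_left (hσ.measureReal_hold_le p) hC

/-- The weight of a request of the job: `m` on the path and `1` elsewhere. -/
noncomputable def weight (σ : Schedule S) (i : ι) (k : ℕ) (P : Finset (S.V i))
    (n : Fin (σ.numReq i k)) : ℝ :=
  if σ.vertex ⟨i, k, n⟩ ∈ P then (S.m i : ℝ) else 1

theorem weight_nonneg (n : Fin (σ.numReq i k)) : 0 ≤ σ.weight i k P n := by
  unfold weight
  split_ifs <;> positivity

/-- Only pairs (holder, spinner) whose intervals meet contribute, which turns the time lost into a
count of pairs that FIFO can bound. -/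
theorem IsLegal.integral_hold_le_sum (hσ : σ.IsLegal) (p : σ.Req) :
    ∫ τ in σ.hold p, σ.lost i k P q τ ∂(volume.restrict (Set.Ico r t)) ≤
      ∑ n ∈ σ.jobReq i k q, σ.weight i k P n *
        (if (σ.hold p ∩ σ.spin ⟨i, k, n⟩).Nonempty then S.L p.1 (σ.res p) else 0) := by
  have hint : ∀ n ∈ σ.jobReq i k q, Integrable (fun τ => σ.weight i k P n *
      (σ.spin ⟨i, k, n⟩).indicator (1 : ℝ → ℝ) τ)
      ((volume.restrict (Set.Ico r t)).restrict (σ.hold p)) := fun n _ =>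
    ((integrable_const (1 : ℝ)).indicator (σ.measurableSet_spin _)).const_mul _
  refine (integral_mono (hσ.integrable_lost _) (integrable_finsetSum _ hint)
    (fun τ => σ.lost_le_sum i k P q τ)).trans ?_
  rw [integral_finsetSum _ hint]
  refine Finset.sum_le_sum fun n _ => ?_
  rw [integral_const_mul, integral_indicator_one (σ.measurableSet_spin _),
    measureReal_restrict_apply (σ.measurableSet_spin _), Set.inter_comm]
  refine mul_le_mul_of_nonneg_left ?_ (σ.weight_nonneg n)
  split_ifs with h
  · exact (measureReal_mono Set.inter_subset_left).trans (hσ.measureReal_hold_le p)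
  · rw [Set.not_nonempty_iff_eq_empty.1 h]
    simp

/-- The time lost is lost while the resource is held. -/
theorem IsLegal.integral_lost_le [Fintype ι] (hσ : σ.IsLegal) (K : ι → Finset ℕ)
    (hK : ∀ j k' v, ∀ τ ∈ Set.Ico r t, σ.Busy j k' v τ → k' ∈ K j) :
    ∫ τ, σ.lost i k P q τ ∂(volume.restrict (Set.Ico r t)) ≤
      ∑ j, ∑ k' ∈ K j, ∑ n ∈ σ.jobReq j k' q,
        ∫ τ in σ.hold ⟨j, k', n⟩, σ.lost i k P q τ ∂(volume.restrict (Set.Ico r t)) := by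
  have hind : ∀ p : σ.Req, Integrable ((σ.hold p).indicator (σ.lost i k P q))
      (volume.restrict (Set.Ico r t)) := fun p =>
    (hσ.integrable_lost _).indicator (σ.measurableSet_hold p)
  have hnn : ∀ (p : σ.Req) (τ : ℝ), 0 ≤ (σ.hold p).indicator (σ.lost i k P q) τ := fun p τ =>
    Set.indicator_nonneg (fun _ _ => hσ.lost_nonneg) _
  have hpt : ∀ τ ∈ Set.Ico r t, σ.lost i k P q τ ≤ ∑ j, ∑ k' ∈ K j, ∑ n ∈ σ.jobReq j k' q,
      (σ.hold ⟨j, k', n⟩).indicator (σ.lost i k P q) τ := by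
    intro τ hτ
    by_cases h0 : σ.lost i k P q τ = 0
    · rw [h0]
      exact Finset.sum_nonneg fun _ _ => Finset.sum_nonneg fun _ _ => Finset.sum_nonneg fun _ _ =>
        hnn _ _
    -- The holder's vertex is busy inside the window, so its job belongs to `K j`.
    · obtain ⟨n, hn, hsp⟩ := exists_spin_of_lost_ne_zero h0
      obtain ⟨⟨j, k', n'⟩, -, hres, hhold⟩ := hσ.held_of_spin _ _ hsp
      rw [mem_jobReq.1 hn] at hres
      have hk' : k' ∈ K j := hK j k' _ τ hτ
        (hσ.busy_of_mem (y := ⟨k', n'⟩) (hσ.hold_subset _ hhold))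
      calc σ.lost i k P q τ = (σ.hold ⟨j, k', n'⟩).indicator (σ.lost i k P q) τ :=
            (Set.indicator_of_mem hhold _).symm
        _ ≤ ∑ n ∈ σ.jobReq j k' q, (σ.hold ⟨j, k', n⟩).indicator (σ.lost i k P q) τ :=
            Finset.single_le_sum
              (f := fun n => (σ.hold ⟨j, k', n⟩).indicator (σ.lost i k P q) τ)
              (fun _ _ => hnn _ _) (mem_jobReq.2 hres)
        _ ≤ ∑ k' ∈ K j, ∑ n ∈ σ.jobReq j k' q,
              (σ.hold ⟨j, k', n⟩).indicator (σ.lost i k P q) τ :=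
            Finset.single_le_sum (f := fun k' => ∑ n ∈ σ.jobReq j k' q,
              (σ.hold ⟨j, k', n⟩).indicator (σ.lost i k P q) τ)
              (fun _ _ => Finset.sum_nonneg fun _ _ => hnn _ _) hk'
        _ ≤ _ := Finset.single_le_sum (f := fun j => ∑ k' ∈ K j, ∑ n ∈ σ.jobReq j k' q,
              (σ.hold ⟨j, k', n⟩).indicator (σ.lost i k P q) τ)
              (fun _ _ => Finset.sum_nonneg fun _ _ => Finset.sum_nonneg fun _ _ => hnn _ _)
              (Finset.mem_univ j)
  refine (setIntegral_mono_on (hσ.integrable_lost _) ?_ measurableSet_Ico hpt).trans (le_of_eq ?_)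
  · exact integrable_finsetSum _ fun _ _ => integrable_finsetSum _ fun _ _ =>
      integrable_finsetSum _ fun _ _ => hind _
  · rw [integral_finsetSum _ fun _ _ => integrable_finsetSum _ fun _ _ =>
      integrable_finsetSum _ fun _ _ => hind _]
    refine Finset.sum_congr rfl fun _ _ => ?_
    rw [integral_finsetSum _ fun _ _ => integrable_finsetSum _ fun _ _ => hind _]
    refine Finset.sum_congr rfl fun _ _ => ?_
    rw [integral_finsetSum _ fun _ _ => hind _]
    exact Finset.sum_congr rfl fun _ _ => integral_indicator (σ.measurableSet_hold _)

/-- The requests of the job issued by the path. -/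
noncomputable def pathReq (σ : Schedule S) (i : ι) (k : ℕ) (P : Finset (S.V i)) (q : ρ) :
    Finset (Fin (σ.numReq i k)) :=
  (σ.jobReq i k q).filter fun n => σ.vertex ⟨i, k, n⟩ ∈ P

theorem IsLegal.sum_weight_le (hσ : σ.IsLegal) :
    ∑ n ∈ σ.jobReq i k q, σ.weight i k P n ≤
      (S.N i q : ℝ) + ((S.m i : ℝ) - 1) * (σ.pathReq i k P q).card := by
  have h1 : ((σ.jobReq i k q).card : ℝ) ≤ S.N i q := by exact_mod_cast hσ.card_jobReq_le i k q
  have h2 : ((σ.pathReq i k P q).card : ℝ) +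
      ((σ.jobReq i k q).filter fun n => ¬ σ.vertex ⟨i, k, n⟩ ∈ P).card =
        (σ.jobReq i k q).card := by
    exact_mod_cast Finset.card_filter_add_card_filter_not _
  simp only [weight]
  rw [Finset.sum_ite, Finset.sum_const, Finset.sum_const, nsmul_eq_mul, nsmul_eq_mul]
  change ((σ.pathReq i k P q).card : ℝ) * _ + _ ≤ _
  linarith

theorem IsLegal.sum_integral_hold_le_count (hσ : σ.IsLegal) (j : ι) (s : Finset ℕ) :
    ∑ k' ∈ s, ∑ n ∈ σ.jobReq j k' q,
        ∫ τ in σ.hold ⟨j, k', n⟩, σ.lost i k P q τ ∂(volume.restrict (Set.Ico r t)) ≤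
      (S.m i : ℝ) * (s.card * S.N j q) * S.L j q := by
  have hm : (0 : ℝ) ≤ S.m i := Nat.cast_nonneg _
  have hb : ∀ k' ∈ s, ∑ n ∈ σ.jobReq j k' q,
      ∫ τ in σ.hold ⟨j, k', n⟩, σ.lost i k P q τ ∂(volume.restrict (Set.Ico r t)) ≤
        S.N j q * (S.m i * S.L j q) := by
    intro k' _
    have h1 : ((σ.jobReq j k' q).card : ℝ) ≤ S.N j q := by
      exact_mod_cast hσ.card_jobReq_le j k' q
    refine (Finset.sum_le_card_nsmul _ _ (S.m i * S.L j q) fun n hn => ?_).trans ?_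
    · have := hσ.integral_hold_le (i := i) (k := k) (P := P) (q := q) (r := r) (t := t)
        ⟨j, k', n⟩ hm fun _ _ => hσ.lost_le
      rwa [mem_jobReq.1 hn] at this
    · rw [nsmul_eq_mul]
      exact mul_le_mul_of_nonneg_right h1 (mul_nonneg hm (S.L_nonneg j q))
  refine (Finset.sum_le_card_nsmul _ _ _ hb).trans (le_of_eq ?_)
  rw [nsmul_eq_mul]
  ring

/-- Under FIFO, the requests of task `j` that a given request waits for are all incomplete at its
issue, so there are at most `m_j` of them. Summing over the waiting requests yields their total
weight. -/
theorem IsLegal.sum_integral_hold_le_fifo (hσ : σ.IsLegal) (hfifo : σ.IsFIFO) (j : ι)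
    (s : Finset ℕ) :
    ∑ k' ∈ s, ∑ n ∈ σ.jobReq j k' q,
        ∫ τ in σ.hold ⟨j, k', n⟩, σ.lost i k P q τ ∂(volume.restrict (Set.Ico r t)) ≤
      ((S.N i q : ℝ) + ((S.m i : ℝ) - 1) * (σ.pathReq i k P q).card) * S.m j * S.L j q := by
  have hL := S.L_nonneg j q
  rw [Finset.sum_sigma' s (fun k' => σ.jobReq j k' q) (fun k' n =>
    ∫ τ in σ.hold ⟨j, k', n⟩, σ.lost i k P q τ ∂(volume.restrict (Set.Ico r t)))]
  calc _ ≤ ∑ y ∈ s.sigma (fun k' => σ.jobReq j k' q), ∑ n ∈ σ.jobReq i k q,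
        σ.weight i k P n *
          (if (σ.hold ⟨j, y⟩ ∩ σ.spin ⟨i, k, n⟩).Nonempty then S.L j q else 0) := by
        refine Finset.sum_le_sum fun y hy => ?_
        have := hσ.integral_hold_le_sum (i := i) (k := k) (P := P) (q := q) (r := r) (t := t)
          ⟨j, y⟩
        rwa [mem_jobReq.1 (Finset.mem_sigma.1 hy).2] at this
    _ = ∑ n ∈ σ.jobReq i k q, σ.weight i k P n *
          (((s.sigma (fun k' => σ.jobReq j k' q)).filter fun y =>
            (σ.hold ⟨j, y⟩ ∩ σ.spin ⟨i, k, n⟩).Nonempty).card * S.L j q) := by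
        rw [Finset.sum_comm]
        refine Finset.sum_congr rfl fun n _ => ?_
        rw [← Finset.mul_sum, ← Finset.sum_filter, Finset.sum_const, nsmul_eq_mul]
    _ ≤ ∑ n ∈ σ.jobReq i k q, σ.weight i k P n * (S.m j * S.L j q) := by
        refine Finset.sum_le_sum fun n hn => mul_le_mul_of_nonneg_left
          (mul_le_mul_of_nonneg_right (Nat.cast_le.2 ?_) hL) (σ.weight_nonneg n)
        refine hσ.card_incomplete_le (τ := σ.issue ⟨i, k, n⟩) _ fun y hy => ?_
        obtain ⟨hy, hne⟩ := Finset.mem_filter.1 hy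
        refine (issue_mem_of_inter hfifo ?_ hne).1
        rw [mem_jobReq.1 hn]
        exact mem_jobReq.1 (Finset.mem_sigma.1 hy).2
    _ = (∑ n ∈ σ.jobReq i k q, σ.weight i k P n) * (S.m j * S.L j q) := by
        rw [Finset.sum_mul]
    _ ≤ _ := by
        rw [mul_assoc]
        exact mul_le_mul_of_nonneg_right hσ.sum_weight_le (mul_nonneg (Nat.cast_nonneg _) hL)

/-- A holder on the path excludes any loss; a holder off the path occupies one executing processor,
leaving `m - 1` to lose. -/
theorem IsLegal.sum_integral_own_le (hσ : σ.IsLegal)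
    (hP : ∀ u ∈ P, ∀ v ∈ P, ∀ τ, σ.Pending i k u τ → σ.Pending i k v τ → u = v) :
    ∑ n ∈ σ.jobReq i k q,
        ∫ τ in σ.hold ⟨i, k, n⟩, σ.lost i k P q τ ∂(volume.restrict (Set.Ico r t)) ≤
      ((S.N i q : ℝ) - (σ.pathReq i k P q).card) * ((S.m i : ℝ) - 1) * S.L i q := by
  have hL := S.L_nonneg i q
  have hm : (0 : ℝ) ≤ (S.m i : ℝ) - 1 := sub_nonneg.2 (by exact_mod_cast S.m_pos i)
  have h1 : ((σ.jobReq i k q).card : ℝ) ≤ S.N i q := by exact_mod_cast hσ.card_jobReq_le i k q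
  have h2 : ((σ.pathReq i k P q).card : ℝ) +
      ((σ.jobReq i k q).filter fun n => ¬ σ.vertex ⟨i, k, n⟩ ∈ P).card =
        (σ.jobReq i k q).card := by
    exact_mod_cast Finset.card_filter_add_card_filter_not _
  calc _ ≤ ∑ n ∈ σ.jobReq i k q,
        if σ.vertex ⟨i, k, n⟩ ∈ P then 0 else ((S.m i : ℝ) - 1) * S.L i q := by
        refine Finset.sum_le_sum fun n hn => ?_
        have key := fun (C : ℝ) (hC : 0 ≤ C) (h : ∀ τ ∈ σ.hold ⟨i, k, n⟩,
          σ.lost i k P q τ ≤ C) => hσ.integral_hold_le (r := r) (t := t) ⟨i, k, n⟩ hC h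
        rw [mem_jobReq.1 hn] at key
        split_ifs with hv
        · have := key 0 le_rfl fun τ hτ => (hσ.lost_eq_zero hP hv hτ).le
          simpa using this
        · refine key _ hm fun τ hτ => ?_
          have h3 := one_le_execCount (hσ.hold_subset_exec i k _ ⟨i, k, n⟩ ⟨n, rfl, rfl⟩ hτ)
          have h4 := hσ.lost_le_sub (i := i) (k := k) (P := P) (q := q) (τ := τ)
          linarith
    _ = ((σ.jobReq i k q).filter fun n => ¬ σ.vertex ⟨i, k, n⟩ ∈ P).card *
          (((S.m i : ℝ) - 1) * S.L i q) := by
        rw [Finset.sum_ite, Finset.sum_const_zero, zero_add, Finset.sum_const, nsmul_eq_mul]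
    _ ≤ _ := by
        rw [mul_assoc]
        exact mul_le_mul_of_nonneg_right (by linarith) (mul_nonneg hm hL)

/-- Without path requests every weight is `1`, so pairs (holder, spinner) are counted. The holder
acquires first, so `Finset.sum_card_pred_le` applies with `acquire` as the increasing function. -/
theorem IsLegal.sum_integral_own_le_fifo (hσ : σ.IsLegal) (hfifo : σ.IsFIFO)
    (h0 : σ.pathReq i k P q = ∅) :
    ∑ n ∈ σ.jobReq i k q,
        ∫ τ in σ.hold ⟨i, k, n⟩, σ.lost i k P q τ ∂(volume.restrict (Set.Ico r t)) ≤
      ((S.N i q : ℝ) * ((S.m i : ℝ) - 1) - S.Delta i q) * S.L i q := by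
  have hL := S.L_nonneg i q
  have hw : ∀ n ∈ σ.jobReq i k q, σ.weight i k P n = 1 := fun n hn =>
    if_neg (Finset.filter_eq_empty_iff.1 h0 hn)
  have hres : ∀ n ∈ σ.jobReq i k q, ∀ n' ∈ σ.jobReq i k q,
      σ.res ⟨i, k, n'⟩ = σ.res ⟨i, k, n⟩ := fun n hn n' hn' =>
    (mem_jobReq.1 hn').trans (mem_jobReq.1 hn).symm
  have hcount := Finset.sum_card_pred_le (σ.jobReq i k q) (fun n => σ.acquire ⟨i, k, n⟩)
    (fun n' n => (σ.hold ⟨i, k, n'⟩ ∩ σ.spin ⟨i, k, n⟩).Nonempty) (S.m i - 1)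
    (fun n' hn' n hn h => (issue_mem_of_inter hfifo (hres n hn n' hn') h).2.1) (by
      intro n hn
      set s := (σ.jobReq i k q).filter
        fun n' => (σ.hold ⟨i, k, n'⟩ ∩ σ.spin ⟨i, k, n⟩).Nonempty with hs
      rcases s.eq_empty_or_nonempty with he | ⟨n₀, hn₀⟩
      · simp [he]
      have hmem : ∀ n' ∈ s, _ := fun n' hn' => issue_mem_of_inter hfifo
        (hres n hn n' (Finset.mem_filter.1 hn').1) (Finset.mem_filter.1 hn').2
      have hnot : n ∉ s := fun h => lt_irrefl _ (hmem n h).2.1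
      -- At its issue `n` is itself incomplete and takes one of the `m` places, which leaves `m - 1`
      -- for the requests it waits for.
      have hcard := hσ.card_incomplete_le (i := i) (τ := σ.issue ⟨i, k, n⟩)
        ((insert n s).map ⟨Sigma.mk k, sigma_mk_injective⟩) (by
          intro y hy
          obtain ⟨n', hn', rfl⟩ := Finset.mem_map.1 hy
          rcases Finset.mem_insert.1 hn' with rfl | hn'
          · exact ⟨le_rfl, (hσ.issue_le_acquire _).trans_lt (hσ.acquire_lt_done _)⟩
          · exact (hmem n' hn').1)
      rw [Finset.card_map, Finset.card_insert_of_notMem hnot] at hcard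
      omega)
  have hmono : ∑ l ∈ Finset.range (σ.jobReq i k q).card, min l (S.m i - 1) ≤
      ∑ l ∈ Finset.range (S.N i q), min l (S.m i - 1) :=
    Finset.sum_le_sum_of_subset (Finset.range_mono (hσ.card_jobReq_le i k q))
  have hle : ((∑ n ∈ σ.jobReq i k q, ((σ.jobReq i k q).filter
      fun n' => (σ.hold ⟨i, k, n'⟩ ∩ σ.spin ⟨i, k, n⟩).Nonempty).card : ℕ) : ℝ) ≤
      (S.N i q : ℝ) * ((S.m i : ℝ) - 1) - S.Delta i q := by
    rw [TaskSystem.Delta, ← sum_range_min_eq _ _ (S.m_pos i)]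
    exact_mod_cast hcount.trans hmono
  refine le_trans ?_ (mul_le_mul_of_nonneg_right hle hL)
  calc _ ≤ ∑ n' ∈ σ.jobReq i k q, ∑ n ∈ σ.jobReq i k q,
          (if (σ.hold ⟨i, k, n'⟩ ∩ σ.spin ⟨i, k, n⟩).Nonempty then S.L i q else 0) := by
        refine Finset.sum_le_sum fun n' hn' => ?_
        have := hσ.integral_hold_le_sum (i := i) (k := k) (P := P) (q := q) (r := r) (t := t)
          ⟨i, k, n'⟩
        rw [mem_jobReq.1 hn'] at this
        refine this.trans (le_of_eq (Finset.sum_congr rfl fun n hn => ?_))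
        rw [hw n hn, one_mul]
    _ = _ := by
        rw [Finset.sum_comm, Nat.cast_sum, Finset.sum_mul]
        refine Finset.sum_congr rfl fun n _ => ?_
        rw [← Finset.sum_filter, Finset.sum_const, nsmul_eq_mul]

/-- The processor time lost by spinning for a resource. -/
theorem IsLegal.integral_lost_le_bound [Fintype ι] (hσ : σ.IsLegal) (hfifo : σ.IsFIFO)
    (hP : ∀ u ∈ P, ∀ v ∈ P, ∀ τ, σ.Pending i k u τ → σ.Pending i k v τ → u = v)
    (hq : 0 < S.N i q) (K : ι → Finset ℕ)
    (hK : ∀ j k' v, ∀ τ ∈ Set.Ico r t, σ.Busy j k' v τ → k' ∈ K j) (hKi : K i = {k})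
    (hKc : ∀ j, j ≠ i → (K j).card ≤ ⌈(S.deadline i + S.deadline j) / S.period j⌉₊) :
    ∫ τ, σ.lost i k P q τ ∂(volume.restrict (Set.Ico r t)) ≤
      S.FI i q (σ.pathReq i k P q).card + S.FO i q (σ.pathReq i k P q).card := by
  refine (hσ.integral_lost_le K hK).trans ?_
  rw [← Finset.add_sum_erase _ _ (Finset.mem_univ i), hKi, Finset.sum_singleton]
  refine add_le_add ?_ ?_
  -- The factor `max (1 - x) 0` is `1` at `x = 0` and `0` for `x ≥ 1`: the correction `Delta` is
  -- used only without path requests.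
  · rcases Nat.eq_zero_or_pos (σ.pathReq i k P q).card with h | h
    · have := hσ.sum_integral_own_le_fifo (r := r) (t := t) hfifo (Finset.card_eq_zero.1 h)
      simpa [TaskSystem.FI, h] using this
    · have h1 : (1 : ℝ) ≤ (σ.pathReq i k P q).card := by exact_mod_cast h
      rw [TaskSystem.FI, max_eq_right (by linarith), zero_mul, sub_zero]
      exact hσ.sum_integral_own_le hP
  · rw [TaskSystem.FO, Finset.filter_ne' Finset.univ i]
    refine Finset.sum_le_sum fun j hj => ?_
    rw [min_mul_of_nonneg _ _ (S.L_nonneg j q)]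
    refine le_min ?_ (hσ.sum_integral_hold_le_fifo hfifo j (K j))
    refine (hσ.sum_integral_hold_le_count j (K j)).trans
      (mul_le_mul_of_nonneg_right ?_ (S.L_nonneg j q))
    rw [mul_assoc]
    refine mul_le_mul_of_nonneg_left ?_ (Nat.cast_nonneg _)
    rcases Nat.eq_zero_or_pos (S.N j q) with h | h
    · simp [h]
    · rw [TaskSystem.eta, if_pos ⟨hq, h⟩]
      exact mul_le_mul_of_nonneg_right (Nat.cast_le.2 (hKc j (Finset.ne_of_mem_erase hj)))
        (Nat.cast_nonneg _)

end Schedule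

/-! ### Response time bound and the earliest deadline miss -/

namespace Schedule

variable {ι : Type*} {ρ : Type*} {S : TaskSystem ι ρ} {σ : Schedule S}

theorem IsLegal.release_add_le (hσ : σ.IsLegal) (i : ι) {k k' : ℕ} (h : k < k') :
    σ.release i k + S.period i ≤ σ.release i k' := by
  induction k', h using Nat.le_induction with
  | base => exact hσ.release_sep i k
  | succ n _ ih =>
    have := hσ.release_sep i n
    have := S.period_pos i
    linarith

theorem IsLegal.measureReal_exec_le (hσ : σ.IsLegal) {i : ι} {k : ℕ} {v : S.V i} {r t : ℝ}
    (h : volume (σ.exec i k v ∩ Set.Iio t) ≤ ENNReal.ofReal (σ.work i k v)) :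
    volume.real (σ.exec i k v ∩ Set.Ico r t) ≤ S.c i v := by
  refine (ENNReal.toReal_le_of_le_ofReal (hσ.work_nonneg i k v)
    ((measure_mono ?_).trans h)).trans (hσ.work_le i k v)
  exact Set.inter_subset_inter_right _ fun x hx => hx.2

theorem IsLegal.volume_exec_le (hσ : σ.IsLegal) (i : ι) (k : ℕ) (v : S.V i) (t : ℝ) :
    volume (σ.exec i k v ∩ Set.Iio t) ≤ ENNReal.ofReal (σ.work i k v) := by
  rw [← (hσ.finish_isLeast i k v).1.2.2.1]
  refine measure_mono fun x hx => ⟨hx.1, ?_⟩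
  exact (hσ.pending_of_busy i k v x (Or.inl hx.1)).2.2

theorem IsLegal.measureReal_exec_lt (hσ : σ.IsLegal) {i : ι} {k : ℕ} {v : S.V i} {r t : ℝ}
    (h : σ.Pending i k v t) :
    volume.real (σ.exec i k v ∩ Set.Ico r t) < S.c i v := by
  have h1 : volume (σ.exec i k v ∩ Set.Ico r t) < ENNReal.ofReal (σ.work i k v) :=
    (measure_mono (Set.inter_subset_inter_right _ fun x hx => hx.2)).trans_lt
      (hσ.volume_exec_lt h)
  refine lt_of_lt_of_le ?_ (hσ.work_le i k v)
  exact (ENNReal.lt_ofReal_iff_toReal_lt h1.ne_top).1 h1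

/-- Bound on the time a job has been active, as long as it has not missed its deadline and jobs
released too early to meet their deadlines afterwards are finished at its release. -/
theorem IsLegal.m_mul_le [Fintype ι] [Fintype ρ] (hσ : σ.IsLegal) (hfifo : σ.IsFIFO) {i : ι}
    {k : ℕ} {l : List (S.V i)} (hl : S.IsCompletePath i l)
    (hpend : ∀ τ, σ.release i k ≤ τ → τ < σ.finish i k (S.tail i) → ∃ u ∈ l, σ.Pending i k u τ)
    {t : ℝ} (ht : σ.release i k ≤ t) (htf : t ≤ σ.finish i k (S.tail i))
    (htD : t ≤ σ.release i k + S.deadline i)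
    (hprev : ∀ j k', σ.finish j k' (S.tail j) ≤ σ.release i k ∨
      σ.release i k - S.deadline j < σ.release j k') :
    (S.m i : ℝ) * (t - σ.release i k) ≤
      ∑ v, volume.real (σ.exec i k v ∩ Set.Ico (σ.release i k) t) +
        ((S.m i : ℝ) - 1) * S.longestPath i +
        ∑ q ∈ Finset.univ.filter (fun q => 0 < S.N i q),
          (Finset.range (S.N i q + 1)).sup' Finset.nonempty_range_add_one
            (fun x => S.FI i q x + S.FO i q x) := by
  set r := σ.release i k with hr
  set P := l.toFinset with hPdef
  have hm : (0 : ℝ) ≤ (S.m i : ℝ) - 1 := sub_nonneg.2 (by exact_mod_cast S.m_pos i)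
  have hP : ∀ u ∈ P, ∀ v ∈ P, ∀ τ, σ.Pending i k u τ → σ.Pending i k v τ → u = v :=
    fun u hu v hv τ h h' =>
      hσ.eq_of_pending hl.1 (List.mem_toFinset.1 hu) (List.mem_toFinset.1 hv) h h'
  have hrel : ∀ j k' v, ∀ τ ∈ Set.Ico r t, σ.Busy j k' v τ →
      r - S.deadline j < σ.release j k' ∧ σ.release j k' < t := by
    intro j k' v τ hτ hb
    obtain ⟨h1, h2⟩ := hσ.lt_finish_of_busy hb
    refine ⟨(hprev j k').resolve_left ?_, h1.trans_lt hτ.2⟩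
    have := hτ.1
    linarith
  -- Jobs of the same task are released at least `T_i ≥ D_i` apart, hence outside the open interval
  -- from `r - D_i` to `t ≤ r + D_i`.
  have hother : ∀ τ ∈ Set.Ico r t, ∀ k' u, σ.Busy i k' u τ → k' = k := by
    intro τ hτ k' u hb
    obtain ⟨h1, h2⟩ := hrel i k' u τ hτ hb
    have hD := S.deadline_le_period i
    rcases lt_trichotomy k' k with h | h | h
    · have := hσ.release_add_le i h
      linarith
    · exact h
    · have := hσ.release_add_le i h
      linarith
  -- Contending jobs of task `j` are released strictly between `r - D_j` and `t`, an interval of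
  -- length at most `D_i + D_j`.
  choose K₀ hK₀ hK₀c using fun j => exists_finset_of_separated (σ.release j)
    (a := r - S.deadline j) (b := t) (S.period_pos j) (hσ.release_sep j)
  let K : ι → Finset ℕ := fun j => if j = i then {k} else K₀ j
  have hK : ∀ j k' v, ∀ τ ∈ Set.Ico r t, σ.Busy j k' v τ → k' ∈ K j := by
    intro j k' v τ hτ hb
    by_cases hj : j = i
    · subst hj
      simp [K, hother τ hτ k' v hb]
    · obtain ⟨h1, h2⟩ := hrel j k' v τ hτ hb
      simpa [K, hj] using hK₀ j k' h1 h2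
  have hKc : ∀ j, j ≠ i → (K j).card ≤ ⌈(S.deadline i + S.deadline j) / S.period j⌉₊ := by
    intro j hj
    simp only [K, if_neg hj]
    refine (hK₀c j).trans (Nat.ceil_le_ceil ?_)
    exact div_le_div_of_nonneg_right (by linarith) (S.period_pos j).le
  have hexec : ∀ v, Integrable ((σ.exec i k v).indicator (1 : ℝ → ℝ))
      (volume.restrict (Set.Ico r t)) := fun v =>
    (integrable_const (1 : ℝ)).indicator (hσ.exec_measurable i k v)
  have hint1 : Integrable (σ.execCount i k) (volume.restrict (Set.Ico r t)) :=
    integrable_finsetSum _ fun v _ => hexec v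
  have hint2 : Integrable (fun τ => ((S.m i : ℝ) - 1) *
      ∑ v ∈ P, (σ.exec i k v).indicator (1 : ℝ → ℝ) τ) (volume.restrict (Set.Ico r t)) :=
    (integrable_finsetSum _ fun v _ => hexec v).const_mul _
  have hint3 : Integrable (fun τ => ∑ q ∈ Finset.univ.filter (fun q => 0 < S.N i q),
      σ.lost i k P q τ) (volume.restrict (Set.Ico r t)) :=
    integrable_finsetSum _ fun q _ => hσ.integrable_lost _
  have hexint : ∀ v, ∫ τ in Set.Ico r t, (σ.exec i k v).indicator (1 : ℝ → ℝ) τ =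
      volume.real (σ.exec i k v ∩ Set.Ico r t) := fun v => by
    rw [integral_indicator_one (hσ.exec_measurable i k v),
      measureReal_restrict_apply (hσ.exec_measurable i k v)]
  have hmain := setIntegral_mono_on (μ := volume) (s := Set.Ico r t)
    (integrable_const (S.m i : ℝ)) ((hint1.add hint2).add hint3) measurableSet_Ico
    fun τ hτ => hσ.m_le (P := P) (hother τ hτ) (by
      obtain ⟨u, hu, hp⟩ := hpend τ hτ.1 (hτ.2.trans_le htf)
      exact ⟨u, List.mem_toFinset.2 hu, hp⟩)
  rw [setIntegral_const, Real.volume_real_Ico_of_le ht, smul_eq_mul, mul_comm] at hmain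
  refine hmain.trans ?_
  rw [integral_add' (hint1.add hint2) hint3, integral_add' hint1 hint2]
  refine add_le_add (add_le_add (le_of_eq ?_) ?_) ?_
  · unfold execCount
    rw [integral_finsetSum _ fun v _ => hexec v]
    exact Finset.sum_congr rfl fun v _ => hexint v
  · rw [integral_const_mul, integral_finsetSum _ fun v _ => hexec v]
    refine mul_le_mul_of_nonneg_left (le_trans (Finset.sum_le_sum fun v _ => ?_)
      (S.sum_le_longestPath hl)) hm
    rw [hexint v]
    exact hσ.measureReal_exec_le (hσ.volume_exec_le i k v t)
  · rw [integral_finsetSum _ fun q _ => hσ.integrable_lost _]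
    refine Finset.sum_le_sum fun q hq => ?_
    refine (hσ.integral_lost_le_bound hfifo hP (Finset.mem_filter.1 hq).2 K hK
      (by simp [K]) hKc).trans ?_
    -- The actual number of path requests is one of the candidates `x ≤ N`.
    refine Finset.le_sup' (fun x => S.FI i q x + S.FO i q x) ?_
    rw [Finset.mem_range, Nat.lt_succ_iff]
    exact (Finset.card_filter_le _ _).trans (hσ.card_jobReq_le i k q)

theorem IsLegal.release_le_finish (hσ : σ.IsLegal) (i : ι) (k : ℕ) :
    σ.release i k ≤ σ.finish i k (S.tail i) :=
  (hσ.finish_isLeast i k (S.tail i)).1.1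

theorem schedulable_iff {i : ι} :
    σ.Schedulable i ↔ ∀ k, σ.finish i k (S.tail i) ≤ σ.release i k + S.deadline i := by
  simp only [Schedulable, wcrt, iSup_le_iff, EReal.coe_le_coe_iff, responseTime,
    sub_le_iff_le_add']

/-- If all tasks meet their deadlines, the response times satisfy the bound. -/
theorem IsLegal.responseTime_le [Fintype ι] [Fintype ρ] (hσ : σ.IsLegal) (hfifo : σ.IsFIFO)
    (h : ∀ j, σ.Schedulable j) (i : ι) (k : ℕ) : σ.responseTime i k ≤ S.fifoBound i := by
  obtain ⟨l, hc, hh, ht, hp⟩ := σ.exists_path_to i k (S.tail i)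
  have hm : (0 : ℝ) < S.m i := by exact_mod_cast S.m_pos i
  have key := hσ.m_mul_le hfifo ⟨hc, hh, ht⟩ hp (hσ.release_le_finish i k) le_rfl
    (schedulable_iff.1 (h i) k) fun j k' => by
      have := schedulable_iff.1 (h j) k'
      rcases le_or_gt (σ.release j k') (σ.release i k - S.deadline j) with h' | h'
      · exact Or.inl (by linarith)
      · exact Or.inr h'
  have hw : ∑ v, volume.real (σ.exec i k v ∩ Set.Ico (σ.release i k) (σ.finish i k (S.tail i))) ≤
      S.totalWCET i :=
    Finset.sum_le_sum fun v _ => hσ.measureReal_exec_le (hσ.volume_exec_le i k v _)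
  rw [TaskSystem.fifoBound, le_div_iff₀ hm, responseTime, mul_comm]
  linarith

/-- If the bounds do not exceed the deadlines, all tasks meet their deadlines: consider the
earliest deadline miss. -/
theorem IsLegal.schedulable_of_fifoBound_le [Fintype ι] [Fintype ρ] (hσ : σ.IsLegal)
    (hfifo : σ.IsFIFO) (h : ∀ j, S.fifoBound j ≤ S.deadline j) (i : ι) : σ.Schedulable i := by
  by_contra hi
  let miss : ι → ℕ → Prop := fun j k => σ.release j k + S.deadline j < σ.finish j k (S.tail j)
  have hmiss : ∀ j, ¬ σ.Schedulable j ↔ ∃ k, miss j k := fun j => by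
    rw [schedulable_iff]
    push Not
    rfl
  obtain ⟨i, k, hik, hmin⟩ : ∃ i k, miss i k ∧ ∀ j k', miss j k' →
      σ.release i k + S.deadline i ≤ σ.release j k' + S.deadline j := by
    -- Releases increase within a task, so the first miss of each task has that task's earliest
    -- missed deadline; finitely many tasks remain to compare.
    let first : ι → ℕ := fun j => sInf {k | miss j k}
    obtain ⟨i₀, hi₀, hmin⟩ := Finset.exists_min_image
      (Finset.univ.filter fun j => ∃ k, miss j k)
      (fun j => σ.release j (first j) + S.deadline j) ⟨i, by simpa using (hmiss i).1 hi⟩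
    simp only [Finset.mem_filter, Finset.mem_univ, true_and] at hi₀ hmin
    refine ⟨i₀, first i₀, Nat.sInf_mem hi₀, fun j k' hj => (hmin j ⟨k', hj⟩).trans ?_⟩
    have hfirst : first j ≤ k' := Nat.sInf_le hj
    rcases hfirst.eq_or_lt with h' | h'
    · rw [h']
    · have := hσ.release_add_le j h'
      have := S.period_pos j
      linarith
  obtain ⟨l, hc, hh, ht, hp⟩ := σ.exists_path_to i k (S.tail i)
  have hm : (0 : ℝ) < S.m i := by exact_mod_cast S.m_pos i
  have hD := S.deadline_pos i
  have hle : σ.release i k ≤ σ.release i k + S.deadline i := by linarith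
  have key := hσ.m_mul_le hfifo ⟨hc, hh, ht⟩ hp hle hik.le le_rfl fun j k' => by
    rcases le_or_gt (σ.release j k') (σ.release i k - S.deadline j) with h' | h'
    · left
      -- Such a job, if unfinished at `σ.release i k`, would miss a deadline no later than this
      -- release, hence before the earliest missed one.
      by_contra hlt
      have := hmin j k' (show _ < _ by linarith)
      linarith
    · exact Or.inr h'
  -- At the missed deadline a path vertex is still pending, so less than the total execution time
  -- has been executed. This strictness contradicts the bound being at most the deadline.
  obtain ⟨u, -, hu⟩ := hp _ hle hik
  have hw : ∑ v, volume.real (σ.exec i k v ∩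
      Set.Ico (σ.release i k) (σ.release i k + S.deadline i)) < S.totalWCET i :=
    Finset.sum_lt_sum (fun v _ => hσ.measureReal_exec_le (hσ.volume_exec_le i k v _))
      ⟨u, Finset.mem_univ u, hσ.measureReal_exec_lt hu⟩
  have hB := h i
  rw [TaskSystem.fifoBound, div_le_iff₀ hm] at hB
  rw [add_sub_cancel_left, mul_comm] at key
  linarith

end Schedule

theorem mainTheorem3 {ι : Type*} {ρ : Type*} [Fintype ι] [Fintype ρ] (S : TaskSystem ι ρ)
    (σ : Schedule S) (hσ : σ.IsLegal) (hfifo : σ.IsFIFO)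
    (h : (∀ j, σ.Schedulable j) ∨ (∀ j, S.fifoBound j ≤ S.deadline j)) (i : ι) :
    σ.wcrt i ≤ (S.fifoBound i : EReal) := by
  have hs : ∀ j, σ.Schedulable j := h.elim id (hσ.schedulable_of_fifoBound_le hfifo)
  exact iSup_le fun k => EReal.coe_le_coe_iff.2 (hσ.responseTime_le hfifo hs i k)
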